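/- A standard quantum circuit on a set of qubits is a finite sequence of layers, each consisting of arbitrary single-qubit unitary gates and CNOT gates that act on pairwise disjoint sets of qubits; its depth is the number of layers and its size is the total number of gates. A standard circuit $C$ on $n+m$ qubits prepares an $n$-qubit state $|\psi\rangle$ (a unit vector in $(\mathbb{C}^2)^{\otimes n}$) with $m$ ancillary qubits if $C(|0\rangle^{\otimes n}\otimes|0\rangle^{\otimes m})=|\psi\rangle\otimes|0\rangle^{\otimes m}$. Theorem (quantum state preparation). There are absolute constants $K,c>0$ such that the following holds for all integers $n\ge 1$ and $m\ge 0$. (1) Every $n$-qubit state $|\psi\rangle$ is prepared with $m$ ancillary qubits by a standard quantum circuit that has both depth at most $K\left(n+\frac{2^n}{n+m}\right)$ and size at most $K\,2^n$. (2) Both bounds are optimal up to a constant factor: there is an $n$-qubit state such that every standard quantum circuit preparing it with $m$ ancillary qubits has depth at least $c\left(n+\frac{2^n}{n+m}\right)$, and there is an $n$-qubit state such that every standard quantum circuit preparing it with $m$ ancillary qubits has size at least $c\,2^n$. -/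

import Mathlib

namespace QSP

/-- Vectors of complex amplitudes on the qubits labelled by `Q`: `ψ x` is the coefficient of the
computational basis vector `|x⟩`, for a bit string `x : Q → Fin 2`. -/
abbrev Amplitudes (Q : Type) : Type := (Q → Fin 2) → ℂ

/-- `ψ` is a (pure) quantum state: a vector of Euclidean norm one. -/
def IsState {Q : Type} [Fintype Q] [DecidableEq Q] (ψ : Amplitudes Q) : Prop :=
  ∑ x, ‖ψ x‖ ^ 2 = 1

/-- The computational basis vector `|0…0⟩`. -/
def ketZero (Q : Type) [Fintype Q] : Amplitudes Q :=
  fun x => if x = 0 then 1 else 0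

/-- The tensor product `φ ⊗ χ` on the disjoint union of two registers of qubits. -/
def tensor {A B : Type} (φ : Amplitudes A) (χ : Amplitudes B) : Amplitudes (A ⊕ B) :=
  fun x => φ (fun a => x (Sum.inl a)) * χ (fun b => x (Sum.inr b))

/-- The elementary gates: an arbitrary single-qubit unitary `U` on qubit `q`, or a CNOT with
control qubit `c` and a different target qubit `t`. -/
inductive Gate (Q : Type) : Type where
  | single (q : Q) (U : Matrix.unitaryGroup (Fin 2) ℂ) : Gate Q
  | cnot (c t : Q) (hct : c ≠ t) : Gate Q

/-- The set of qubits on which a gate acts. -/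
def Gate.support {Q : Type} [DecidableEq Q] : Gate Q → Finset Q
  | .single q _ => {q}
  | .cnot c t _ => {c, t}

/-- The action of a gate on amplitudes. The CNOT gate maps `|x⟩` to `|x'⟩`, where `x'` is `x` with
`x t` replaced by `x t + x c` modulo 2; as `x ↦ x'` is an involution, the new amplitude at `x` is
the old one at `x'`. -/
noncomputable def Gate.apply {Q : Type} [DecidableEq Q] : Gate Q → Amplitudes Q → Amplitudes Q
  | .single q U, ψ => fun x => ∑ b : Fin 2, U.1 (x q) b * ψ (Function.update x q b)
  | .cnot c t _, ψ => fun x => ψ (Function.update x t (x t + x c))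

/-- A layer: gates acting on pairwise disjoint sets of qubits (executed in one time step). -/
structure Layer (Q : Type) [DecidableEq Q] : Type where
  gates : List (Gate Q)
  disjoint : gates.Pairwise (fun g h => Disjoint g.support h.support)

/-- The action of a layer. Its gates commute, so the order of the list is irrelevant. -/
noncomputable def Layer.apply {Q : Type} [DecidableEq Q] (L : Layer Q) (ψ : Amplitudes Q) :
    Amplitudes Q :=
  L.gates.foldl (fun φ g => g.apply φ) ψ

/-- A standard quantum circuit (single-qubit and CNOT gates) on the qubits labelled by `Q`:
a finite sequence of layers, the first one being executed first. -/
structure Circuit (Q : Type) [DecidableEq Q] : Type where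
  layers : List (Layer Q)

/-- The action of a circuit. -/
noncomputable def Circuit.apply {Q : Type} [DecidableEq Q] (C : Circuit Q) (ψ : Amplitudes Q) :
    Amplitudes Q :=
  C.layers.foldl (fun φ L => L.apply φ) ψ

/-- The depth of a circuit: its number of layers. -/
def Circuit.depth {Q : Type} [DecidableEq Q] (C : Circuit Q) : ℕ :=
  C.layers.length

/-- The size of a circuit: its total number of gates. -/
def Circuit.size {Q : Type} [DecidableEq Q] (C : Circuit Q) : ℕ :=
  (C.layers.map (fun L => L.gates.length)).sum

/-- The circuit `C` prepares the `n`-qubit state `ψ` with `m` ancillary qubits, which start in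
`|0⟩` and are restored to `|0⟩`: `C (|0ⁿ⟩ ⊗ |0ᵐ⟩) = ψ ⊗ |0ᵐ⟩`. -/
def Prepares {n m : ℕ} (C : Circuit (Fin n ⊕ Fin m)) (ψ : Amplitudes (Fin n)) : Prop :=
  C.apply (tensor (ketZero (Fin n)) (ketZero (Fin m))) = tensor ψ (ketZero (Fin m))

end QSP

/-! Upper bounds, few ancillas. A state is built one qubit at a time. Appending a qubit takes a
y-rotation for the moduli and a z-rotation for the relative phase, both multiplexed by the qubits
already present (`exists_maps_append`); a y-rotation of a fresh qubit is a z-rotation between fixed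
single-qubit gates. A multiplexed z-rotation on N qubits is diagonal, and Fourier inversion writes
it as one phase for each parity containing the target. To reach these 2^(N-1) parities in depth
O(2^N/N), choose a block B of 2^b qubits containing the target, with N ≤ 4·2^b, and let p be the
number of the others. A Hamming code partitions the relevant parities inside the block into balls of
|B| elements. For one code word the block is made to hold all parities of its ball at once; then all
block qubits walk in parallel through the 2^p combinations with the other qubits, in orders chosen
so that no two use the same control at the same time (`mapsPhase_multiplexed_of_perm`). The depths
O(2^j/j) of the successive qubits sum to the same order (`exists_maps_prepare`).

Upper bounds, many ancillas. Write n = ℓ + k and use a binary tree of height k whose flags mark the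
path given by the first k bits. Rotations of the flags create the superposition of paths level by
level, and all leaves prepare their ℓ-qubit states simultaneously, each controlled by its flag, in
depth O(2^ℓ/ℓ) (`exists_maps_path`). The word w is collected at the root (`maps_merge`) and copied
to the output. Since the tree content is a function of w that routing from the root can compute
(`maps_route`), it can be erased in depth O(n). The tree has O(2^k ℓ) qubits, and k is increased as
long as the tree fits into the ancillas and the size stays O(2^n).

Lower bounds. For a fixed arrangement of N gates the reachable states lie in the image of a C¹ map
with 8N + 2 real parameters, so by Hausdorff dimension countably many arrangements with 8N + 2 <
2^(n+1) miss some state (`exists_state_forall_run_ne`). This bounds the size, and a layer has at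
most n + m gates, which gives the depth bound 2^n/(n+m). For the depth bound n, only the backward
light cone of the n output qubits matters; it has at most n(2^d - 1) gates at depth d, regardless of
m (`Prepares.exists_run`). -/

set_option linter.unusedSectionVars false

namespace QSP

/-! ### Calculus of circuits acting on families of states -/

section Basics

variable {Q Q' A B : Type} [DecidableEq Q] [DecidableEq Q'] [DecidableEq A] [DecidableEq B]

/-! ### Lists of gates -/

/-- The action of a list of gates, the first one being executed first. -/
noncomputable def run (l : List (Gate Q)) (ψ : Amplitudes Q) : Amplitudes Q :=
  l.foldl (fun φ g => g.apply φ) ψ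

@[simp] theorem run_nil (ψ : Amplitudes Q) : run [] ψ = ψ := rfl

@[simp] theorem run_cons (g : Gate Q) (l : List (Gate Q)) (ψ : Amplitudes Q) :
    run (g :: l) ψ = run l (g.apply ψ) := rfl

theorem run_append (l l' : List (Gate Q)) (ψ : Amplitudes Q) :
    run (l ++ l') ψ = run l' (run l ψ) := by
  simp [run, List.foldl_append]

theorem Layer.apply_eq_run (L : Layer Q) (ψ : Amplitudes Q) : L.apply ψ = run L.gates ψ := rfl

/-- All gates of a circuit, in the order of execution. -/
def Circuit.gates (C : Circuit Q) : List (Gate Q) :=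
  C.layers.flatMap (fun L => L.gates)

theorem Circuit.apply_eq_run (C : Circuit Q) (ψ : Amplitudes Q) :
    C.apply ψ = run C.gates ψ := by
  obtain ⟨Ls⟩ := C
  simp only [Circuit.apply, Circuit.gates]
  induction Ls generalizing ψ with
  | nil => rfl
  | cons L Ls ih =>
    rw [List.foldl_cons, ih, List.flatMap_cons, run_append]
    rfl

theorem Circuit.size_eq_length (C : Circuit Q) : C.size = C.gates.length := by
  simp [Circuit.size, Circuit.gates, List.length_flatMap]

theorem Gate.apply_add (g : Gate Q) (ψ φ : Amplitudes Q) :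
    g.apply (ψ + φ) = g.apply ψ + g.apply φ := by
  cases g with
  | single q U =>
    funext x
    simp only [Gate.apply, Pi.add_apply, mul_add, Finset.sum_add_distrib]
  | cnot c t h => rfl

theorem Gate.apply_smul (g : Gate Q) (a : ℂ) (ψ : Amplitudes Q) :
    g.apply (a • ψ) = a • g.apply ψ := by
  cases g with
  | single q U =>
    funext x
    simp only [Gate.apply, Pi.smul_apply, smul_eq_mul, Finset.mul_sum]
    exact Finset.sum_congr rfl fun b _ => by ring
  | cnot c t h => rfl

theorem run_add (l : List (Gate Q)) (ψ φ : Amplitudes Q) :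
    run l (ψ + φ) = run l ψ + run l φ := by
  induction l generalizing ψ φ with
  | nil => rfl
  | cons g l ih => simp [Gate.apply_add, ih]

theorem run_smul (l : List (Gate Q)) (a : ℂ) (ψ : Amplitudes Q) :
    run l (a • ψ) = a • run l ψ := by
  induction l generalizing ψ with
  | nil => rfl
  | cons g l ih => simp [Gate.apply_smul, ih]

/-- The action of a circuit as a linear map. -/
noncomputable def Circuit.toLinearMap (C : Circuit Q) : Amplitudes Q →ₗ[ℂ] Amplitudes Q where
  toFun := C.apply
  map_add' ψ φ := by simp only [Circuit.apply_eq_run, run_add]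
  map_smul' a ψ := by simp only [Circuit.apply_eq_run, run_smul, RingHom.id_apply]

theorem Circuit.apply_sum {ι : Type*} (C : Circuit Q) (s : Finset ι) (a : ι → ℂ)
    (ψ : ι → Amplitudes Q) :
    C.apply (∑ i ∈ s, a i • ψ i) = ∑ i ∈ s, a i • C.apply (ψ i) := by
  have := map_sum C.toLinearMap (fun i => a i • ψ i) s
  simp only [map_smul] at this
  exact this

/-! ### Inverses -/

/-- The inverse gate. -/
def Gate.inv : Gate Q → Gate Q
  | .single q U => .single q U⁻¹
  | .cnot c t h => .cnot c t h

theorem Gate.support_inv (g : Gate Q) : g.inv.support = g.support := by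
  cases g <;> rfl

theorem single_apply_single_apply (q : Q) (U V : Matrix.unitaryGroup (Fin 2) ℂ)
    (ψ : Amplitudes Q) :
    (Gate.single q V).apply ((Gate.single q U).apply ψ) = (Gate.single q (V * U)).apply ψ := by
  funext x
  simp only [Gate.apply, Function.update_self, Function.update_idem, Matrix.UnitaryGroup.mul_val,
    Matrix.mul_apply, Finset.mul_sum, Finset.sum_mul]
  rw [Finset.sum_comm]
  exact Finset.sum_congr rfl fun b _ => Finset.sum_congr rfl fun b' _ => by ring

theorem single_one_apply (q : Q) (ψ : Amplitudes Q) : (Gate.single q 1).apply ψ = ψ := by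
  funext x
  simp [Gate.apply, Matrix.one_apply]

theorem Gate.inv_apply_apply (g : Gate Q) (ψ : Amplitudes Q) : g.inv.apply (g.apply ψ) = ψ := by
  cases g with
  | single q U =>
    simp only [Gate.inv]
    rw [single_apply_single_apply, inv_mul_cancel, single_one_apply]
  | cnot c t h =>
    funext x
    simp only [Gate.inv, Gate.apply, Function.update_self, Function.update_idem,
      Function.update_of_ne h]
    congr 1
    funext q
    by_cases hq : q = t
    · subst hq
      simp only [Function.update_self, add_assoc]
      generalize x q = a
      generalize x c = b
      revert a b
      decide
    · simp [Function.update_of_ne hq]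

theorem run_inv_run (l : List (Gate Q)) (ψ : Amplitudes Q) :
    run (l.map Gate.inv).reverse (run l ψ) = ψ := by
  induction l generalizing ψ with
  | nil => rfl
  | cons g l ih =>
    rw [List.map_cons, List.reverse_cons, run_append, run_cons g l, ih, run_cons, run_nil,
      Gate.inv_apply_apply]

/-- The inverse layer. -/
def Layer.inv (L : Layer Q) : Layer Q where
  gates := (L.gates.map Gate.inv).reverse
  disjoint := by
    rw [List.pairwise_reverse, List.pairwise_map]
    refine L.disjoint.imp fun {g h} hgh => ?_
    rw [Gate.support_inv, Gate.support_inv]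
    exact hgh.symm

/-- The inverse circuit. -/
def Circuit.inv (C : Circuit Q) : Circuit Q := ⟨(C.layers.map Layer.inv).reverse⟩

theorem Circuit.depth_inv (C : Circuit Q) : C.inv.depth = C.depth := by
  simp [Circuit.depth, Circuit.inv]

theorem Circuit.inv_apply_apply (C : Circuit Q) (ψ : Amplitudes Q) :
    C.inv.apply (C.apply ψ) = ψ := by
  obtain ⟨Ls⟩ := C
  simp only [Circuit.apply, Circuit.inv]
  induction Ls generalizing ψ with
  | nil => rfl
  | cons L Ls ih =>
    rw [List.foldl_cons, List.map_cons, List.reverse_cons, List.foldl_append, ih]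
    exact run_inv_run L.gates ψ

/-! ### Embedding registers into larger ones -/

/-- The gate transported along an injection of registers. -/
def Gate.map (f : Q ↪ Q') : Gate Q → Gate Q'
  | .single q U => .single (f q) U
  | .cnot c t h => .cnot (f c) (f t) (fun e => h (f.injective e))

theorem Gate.support_map (f : Q ↪ Q') (g : Gate Q) :
    (g.map f).support = g.support.map f := by
  cases g <;> simp [Gate.map, Gate.support]

/-- The layer transported along an injection of registers. -/
def Layer.map (f : Q ↪ Q') (L : Layer Q) : Layer Q' where
  gates := L.gates.map (Gate.map f)
  disjoint := by
    rw [List.pairwise_map]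
    refine L.disjoint.imp fun {g h} hgh => ?_
    rw [Gate.support_map, Gate.support_map]
    exact (Finset.disjoint_map f).2 hgh

/-- The circuit transported along an injection of registers. -/
def Circuit.map (f : Q ↪ Q') (C : Circuit Q) : Circuit Q' := ⟨C.layers.map (Layer.map f)⟩

theorem Circuit.depth_map (f : Q ↪ Q') (C : Circuit Q) : (C.map f).depth = C.depth := by
  simp [Circuit.depth, Circuit.map]

theorem Circuit.size_map (f : Q ↪ Q') (C : Circuit Q) : (C.map f).size = C.size := by
  simp [Circuit.size, Circuit.map, Layer.map, Function.comp_def]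

theorem Circuit.gates_map (f : Q ↪ Q') (C : Circuit Q) :
    (C.map f).gates = C.gates.map (Gate.map f) := by
  simp [Circuit.gates, Circuit.map, Layer.map, List.flatMap_map, List.map_flatMap]

/-- The bit strings `x` and `x'` agree outside the range of `f`. -/
def AgreeOff (f : Q ↪ Q') (x x' : Q' → Fin 2) : Prop :=
  ∀ p, p ∉ Set.range f → x' p = x p

open Classical in
/-- The state `ψ` on the qubits in the range of `f`, and the basis state `|x⟩` on the others. -/
noncomputable def extend (f : Q ↪ Q') (ψ : Amplitudes Q) (x : Q' → Fin 2) : Amplitudes Q' :=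
  fun x' => if AgreeOff f x x' then ψ (x' ∘ f) else 0

theorem agreeOff_update_iff (f : Q ↪ Q') (x x' : Q' → Fin 2) (q : Q) (b : Fin 2) :
    AgreeOff f x (Function.update x' (f q) b) ↔ AgreeOff f x x' := by
  refine forall_congr' fun p => imp_congr_right fun hp => ?_
  rw [Function.update_of_ne]
  rintro rfl
  exact hp ⟨q, rfl⟩

open Classical in
theorem extend_update (f : Q ↪ Q') (ψ : Amplitudes Q) (x x' : Q' → Fin 2) (q : Q) (b : Fin 2) :
    extend f ψ x (Function.update x' (f q) b) =
      if AgreeOff f x x' then ψ (Function.update (x' ∘ f) q b) else 0 := by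
  rw [extend, agreeOff_update_iff, Function.update_comp_eq_of_injective x' f.injective]

/-- A gate inside the range of `f` neither reads nor changes the other qubits. This moves
constructions on small registers into large ones. -/
theorem Gate.map_apply_extend (f : Q ↪ Q') (g : Gate Q) (ψ : Amplitudes Q) (x : Q' → Fin 2) :
    (g.map f).apply (extend f ψ x) = extend f (g.apply ψ) x := by
  funext x'
  cases g with
  | single q U =>
    simp only [Gate.map, Gate.apply, extend_update]
    simp only [extend]
    split_ifs <;> simp
  | cnot c t h =>
    simp only [Gate.map, Gate.apply, extend_update]
    rfl

theorem run_map_extend (f : Q ↪ Q') (l : List (Gate Q)) (ψ : Amplitudes Q) (x : Q' → Fin 2) :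
    run (l.map (Gate.map f)) (extend f ψ x) = extend f (run l ψ) x := by
  induction l generalizing ψ with
  | nil => rfl
  | cons g l ih => rw [List.map_cons, run_cons, Gate.map_apply_extend, ih, run_cons]

theorem Circuit.map_apply_extend (f : Q ↪ Q') (C : Circuit Q) (ψ : Amplitudes Q)
    (x : Q' → Fin 2) : (C.map f).apply (extend f ψ x) = extend f (C.apply ψ) x := by
  rw [Circuit.apply_eq_run, Circuit.apply_eq_run, Circuit.gates_map, run_map_extend]

theorem extend_smul (f : Q ↪ Q') (a : ℂ) (ψ : Amplitudes Q) (x : Q' → Fin 2) :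
    extend f (a • ψ) x = a • extend f ψ x := by
  funext x'
  simp only [extend, Pi.smul_apply, smul_eq_mul]
  split_ifs <;> simp

theorem extend_add (f : Q ↪ Q') (ψ φ : Amplitudes Q) (x : Q' → Fin 2) :
    extend f (ψ + φ) x = extend f ψ x + extend f φ x := by
  funext x'
  simp only [extend, Pi.add_apply]
  split_ifs <;> simp

theorem extend_sum {ι : Type*} (f : Q ↪ Q') (s : Finset ι) (ψ : ι → Amplitudes Q)
    (x : Q' → Fin 2) : extend f (∑ i ∈ s, ψ i) x = ∑ i ∈ s, extend f (ψ i) x := by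
  classical
  induction s using Finset.induction_on with
  | empty => funext x'; simp [extend]
  | insert i s hi ih => rw [Finset.sum_insert hi, Finset.sum_insert hi, extend_add, ih]

/-! ### Basis states and tensor products -/

/-- The computational basis vector `|x⟩`. -/
noncomputable def ket [Fintype Q] (x : Q → Fin 2) : Amplitudes Q :=
  fun x' => if x' = x then 1 else 0

theorem ketZero_eq_ket [Fintype Q] : ketZero Q = ket 0 := by
  funext x
  simp [ketZero, ket]

theorem eq_sum_ket [Fintype Q] (ψ : Amplitudes Q) : ψ = ∑ x, ψ x • ket x := by
  funext x'
  simp [ket, Finset.sum_apply]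

theorem extend_ket [Fintype Q] [Fintype Q'] (f : Q ↪ Q') (u : Q → Fin 2) (x y : Q' → Fin 2)
    (hu : ∀ q, y (f q) = u q) (hx : ∀ p, p ∉ Set.range f → y p = x p) :
    extend f (ket u) x = ket y := by
  funext x'
  simp only [extend, ket]
  by_cases h : x' = y
  · subst h
    rw [if_pos (show AgreeOff f x x' from hx), if_pos (show x' ∘ f = u from funext hu),
      if_pos rfl]
  · rw [if_neg h]
    split_ifs with h1 h2
    · refine absurd (funext fun p => ?_) h
      by_cases hp : p ∈ Set.range f
      · obtain ⟨q, rfl⟩ := hp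
        rw [hu, ← h2]
        rfl
      · rw [h1 p hp, hx p hp]
    · rfl
    · rfl

theorem tensor_ket [Fintype A] [Fintype B] (a : A → Fin 2) (b : B → Fin 2) :
    tensor (ket a) (ket b) = ket (Sum.elim a b) := by
  funext x
  have : x = Sum.elim a b ↔ (fun i => x (Sum.inl i)) = a ∧ (fun i => x (Sum.inr i)) = b := by
    constructor
    · rintro rfl
      exact ⟨rfl, rfl⟩
    · rintro ⟨rfl, rfl⟩
      exact (Sum.elim_comp_inl_inr x).symm
  simp only [tensor, ket, this]
  split_ifs with h1 h2 h3 h4 <;> simp_all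

theorem tensor_smul_left (c : ℂ) (φ : Amplitudes A) (χ : Amplitudes B) :
    tensor (c • φ) χ = c • tensor φ χ := by
  funext x
  simp [tensor, mul_assoc]

theorem tensor_smul_right (c : ℂ) (φ : Amplitudes A) (χ : Amplitudes B) :
    tensor φ (c • χ) = c • tensor φ χ := by
  funext x
  simp [tensor, mul_left_comm]

theorem tensor_sum_left {ι : Type*} (s : Finset ι) (φ : ι → Amplitudes A) (χ : Amplitudes B) :
    tensor (∑ i ∈ s, φ i) χ = ∑ i ∈ s, tensor (φ i) χ := by
  funext x
  simp [tensor, Finset.sum_apply, Finset.sum_mul]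

theorem tensor_sum_right {ι : Type*} (s : Finset ι) (φ : Amplitudes A) (χ : ι → Amplitudes B) :
    tensor φ (∑ i ∈ s, χ i) = ∑ i ∈ s, tensor φ (χ i) := by
  funext x
  simp [tensor, Finset.sum_apply, Finset.mul_sum]

theorem Gate.map_inl_apply_tensor (g : Gate A) (φ : Amplitudes A) (χ : Amplitudes B) :
    (g.map Function.Embedding.inl).apply (tensor φ χ) = tensor (g.apply φ) χ := by
  funext x
  cases g with
  | single q U =>
    simp only [Gate.map, Gate.apply, tensor, Function.Embedding.inl_apply, Finset.sum_mul]
    refine Finset.sum_congr rfl fun b _ => ?_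
    rw [mul_assoc]
    congr 3
    · funext a
      simp [Function.update_apply]
  | cnot c t h =>
    simp only [Gate.map, Gate.apply, tensor, Function.Embedding.inl_apply]
    congr 2
    · funext a
      simp [Function.update_apply]

theorem Gate.map_inr_apply_tensor (g : Gate B) (φ : Amplitudes A) (χ : Amplitudes B) :
    (g.map Function.Embedding.inr).apply (tensor φ χ) = tensor φ (g.apply χ) := by
  funext x
  cases g with
  | single q U =>
    simp only [Gate.map, Gate.apply, tensor, Function.Embedding.inr_apply, Finset.mul_sum]
    refine Finset.sum_congr rfl fun b _ => ?_
    rw [mul_left_comm]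
    congr 3
    · funext a
      simp [Function.update_apply]
  | cnot c t h =>
    simp only [Gate.map, Gate.apply, tensor, Function.Embedding.inr_apply]
    congr 2
    · funext a
      simp [Function.update_apply]

theorem run_map_inl_tensor (l : List (Gate A)) (φ : Amplitudes A) (χ : Amplitudes B) :
    run (l.map (Gate.map Function.Embedding.inl)) (tensor φ χ) = tensor (run l φ) χ := by
  induction l generalizing φ with
  | nil => rfl
  | cons g l ih => rw [List.map_cons, run_cons, Gate.map_inl_apply_tensor, ih, run_cons]

theorem run_map_inr_tensor (l : List (Gate B)) (φ : Amplitudes A) (χ : Amplitudes B) :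
    run (l.map (Gate.map Function.Embedding.inr)) (tensor φ χ) = tensor φ (run l χ) := by
  induction l generalizing χ with
  | nil => rfl
  | cons g l ih => rw [List.map_cons, run_cons, Gate.map_inr_apply_tensor, ih, run_cons]

/-- Two layers on disjoint registers, executed in the same time step. -/
def Layer.par (L : Layer A) (M : Layer B) : Layer (A ⊕ B) where
  gates := L.gates.map (Gate.map Function.Embedding.inl) ++
    M.gates.map (Gate.map Function.Embedding.inr)
  disjoint := by
    rw [List.pairwise_append]
    refine ⟨(L.map Function.Embedding.inl).disjoint, (M.map Function.Embedding.inr).disjoint, ?_⟩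
    intro g hg h hh
    obtain ⟨g, -, rfl⟩ := List.mem_map.1 hg
    obtain ⟨h, -, rfl⟩ := List.mem_map.1 hh
    rw [Gate.support_map, Gate.support_map, Finset.disjoint_left]
    intro q hq hq'
    obtain ⟨a, -, rfl⟩ := Finset.mem_map.1 hq
    obtain ⟨b, -, h⟩ := Finset.mem_map.1 hq'
    simp at h

theorem Layer.par_apply_tensor (L : Layer A) (M : Layer B) (φ : Amplitudes A)
    (χ : Amplitudes B) : (L.par M).apply (tensor φ χ) = tensor (L.apply φ) (M.apply χ) := by
  simp only [Layer.apply_eq_run, Layer.par, run_append, run_map_inl_tensor, run_map_inr_tensor]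

/-! ### Transformations implemented in bounded depth -/

/-- Some circuit of depth at most `d` maps the state `s i` to the state `t i` for every `i`. -/
def Maps {ι : Type*} (d : ℕ) (s t : ι → Amplitudes Q) : Prop :=
  ∃ C : Circuit Q, C.depth ≤ d ∧ ∀ i, C.apply (s i) = t i

namespace Maps

variable {ι κ : Type*} {d d' : ℕ} {s t u : ι → Amplitudes Q}

theorem mono (h : Maps d s t) (hd : d ≤ d') : Maps d' s t := by
  obtain ⟨C, hC, h⟩ := h
  exact ⟨C, hC.trans hd, h⟩

theorem refl (s : ι → Amplitudes Q) : Maps 0 s s := ⟨⟨[]⟩, le_rfl, fun _ => rfl⟩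

theorem trans (h : Maps d s t) (h' : Maps d' t u) : Maps (d + d') s u := by
  obtain ⟨C, hC, h⟩ := h
  obtain ⟨C', hC', h'⟩ := h'
  refine ⟨⟨C.layers ++ C'.layers⟩, ?_, fun i => ?_⟩
  · simp only [Circuit.depth, List.length_append] at *
    omega
  · rw [← h', ← h]
    simp [Circuit.apply, List.foldl_append]

/-- Inverting each layer keeps the depth. All uncomputation of ancillas rests on this. -/
theorem symm (h : Maps d s t) : Maps d t s := by
  obtain ⟨C, hC, h⟩ := h
  refine ⟨C.inv, (C.depth_inv).trans_le hC, fun i => ?_⟩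
  rw [← h, Circuit.inv_apply_apply]

theorem comp (h : Maps d s t) (f : κ → ι) : Maps d (fun k => s (f k)) (fun k => t (f k)) := by
  obtain ⟨C, hC, h⟩ := h
  exact ⟨C, hC, fun k => h (f k)⟩

theorem congr {s' t' : ι → Amplitudes Q} (h : Maps d s t) (hs : ∀ i, s i = s' i)
    (ht : ∀ i, t i = t' i) : Maps d s' t' := by
  obtain rfl : s = s' := funext hs
  obtain rfl : t = t' := funext ht
  exact h

theorem smul (h : Maps d s t) (a : ι → ℂ) :
    Maps d (fun i => a i • s i) (fun i => a i • t i) := by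
  obtain ⟨C, hC, h⟩ := h
  refine ⟨C, hC, fun i => ?_⟩
  simp only [← h]
  exact map_smul C.toLinearMap _ _

/-- Linearity. It is usable because `Maps` asks for a single circuit for the whole family:
correctness on basis states passes to superpositions. -/
theorem sum {J : Type*} (S : κ → Finset J) (f : κ → J → ι) (a : κ → J → ℂ) (h : Maps d s t) :
    Maps d (fun k => ∑ j ∈ S k, a k j • s (f k j)) (fun k => ∑ j ∈ S k, a k j • t (f k j)) := by
  obtain ⟨C, hC, h⟩ := h
  refine ⟨C, hC, fun k => ?_⟩
  simp only [Circuit.apply_sum, h]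

/-- The contents of the spectator qubits join the index, so the same circuit serves all of them and
may later be used in superposition. -/
theorem extend (f : Q ↪ Q') (h : Maps d s t) :
    Maps d (fun p : ι × (Q' → Fin 2) => QSP.extend f (s p.1) p.2)
      (fun p => QSP.extend f (t p.1) p.2) := by
  obtain ⟨C, hC, h⟩ := h
  refine ⟨C.map f, (C.depth_map f).trans_le hC, fun p => ?_⟩
  rw [Circuit.map_apply_extend, h]

/-- Padding with empty layers makes the depth exact, so that two circuits can be zipped layer by
layer in `par`. -/
theorem exists_layers (h : Maps d s t) :
    ∃ Ls : List (Layer Q), Ls.length = d ∧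
      ∀ i, Ls.foldl (fun φ L => L.apply φ) (s i) = t i := by
  obtain ⟨C, hC, h⟩ := h
  refine ⟨C.layers ++ List.replicate (d - C.depth) ⟨[], List.Pairwise.nil⟩, ?_, fun i => ?_⟩
  · simp only [Circuit.depth, List.length_append, List.length_replicate] at *
    omega
  · rw [List.foldl_append, ← h]
    change List.foldl _ (C.apply (s i)) _ = _
    generalize C.apply (s i) = φ
    induction d - C.depth with
    | zero => rfl
    | succ n ih => exact ih

theorem foldl_zipWith_par (Ls : List (Layer A)) (Ms : List (Layer B))
    (hl : Ls.length = Ms.length) (φ : Amplitudes A) (χ : Amplitudes B) :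
    (List.zipWith Layer.par Ls Ms).foldl (fun φ L => L.apply φ) (tensor φ χ) =
      tensor (Ls.foldl (fun φ L => L.apply φ) φ) (Ms.foldl (fun φ L => L.apply φ) χ) := by
  induction Ls generalizing Ms φ χ with
  | nil =>
    obtain rfl : Ms = [] := List.length_eq_zero_iff.1 hl.symm
    rfl
  | cons L Ls ih =>
    cases Ms with
    | nil => simp at hl
    | cons M Ms =>
      rw [List.zipWith_cons_cons, List.foldl_cons, Layer.par_apply_tensor,
        ih Ms (by simpa using hl), List.foldl_cons, List.foldl_cons]

theorem par {s t : ι → Amplitudes A} {s' t' : κ → Amplitudes B} (h : Maps d s t)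
    (h' : Maps d s' t') :
    Maps d (fun p : ι × κ => tensor (s p.1) (s' p.2)) (fun p => tensor (t p.1) (t' p.2)) := by
  obtain ⟨Ls, hL, h⟩ := h.exists_layers
  obtain ⟨Ms, hM, h'⟩ := h'.exists_layers
  refine ⟨⟨List.zipWith Layer.par Ls Ms⟩, ?_, fun p => ?_⟩
  · simp [Circuit.depth, hL, hM]
  · simp only [← h, ← h']
    exact foldl_zipWith_par Ls Ms (hL.trans hM.symm) _ _

theorem extend_ket [Fintype Q] [Fintype Q'] {u v : κ → Q → Fin 2} (f : Q ↪ Q')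
    (h : Maps d (fun i => ket (u i)) (fun i => ket (v i))) (x y : ι → Q' → Fin 2) (k : ι → κ)
    (hx : ∀ i q, x i (f q) = u (k i) q) (hy : ∀ i q, y i (f q) = v (k i) q)
    (hxy : ∀ i p, p ∉ Set.range f → y i p = x i p) :
    Maps d (fun i => ket (x i)) (fun i => ket (y i)) := by
  refine ((h.extend f).comp (fun i => (k i, x i))).congr (fun i => ?_) (fun i => ?_)
  · exact QSP.extend_ket f _ _ _ (hx i) fun _ _ => rfl
  · exact QSP.extend_ket f _ _ _ (hy i) (hxy i)

end Maps

/-! ### Layers -/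

theorem cnot_apply_ket [Fintype Q] (c t : Q) (h : c ≠ t) (x : Q → Fin 2) :
    (Gate.cnot c t h).apply (ket x) = ket (Function.update x t (x t + x c)) := by
  funext x'
  simp only [Gate.apply, ket]
  congr 1
  rw [eq_iff_iff]
  have key : ∀ y : Q → Fin 2, Function.update (Function.update y t (y t + y c)) t
      ((Function.update y t (y t + y c)) t + (Function.update y t (y t + y c)) c) = y := by
    intro y
    rw [Function.update_self, Function.update_of_ne h, Function.update_idem]
    have : ∀ a b : Fin 2, a + b + b = a := by decide
    rw [this, Function.update_eq_self]
  constructor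
  · rintro rfl
    exact (key x').symm
  · rintro rfl
    exact key x

/-- The bit string `x` after adding, for every `i`, the bit `c i` to the bit `t i`. -/
def xorAt {ι : Type*} [Fintype ι] (c t : ι → Q) (x : Q → Fin 2) : Q → Fin 2 :=
  fun q => x q + ∑ i, if t i = q then x (c i) else 0

theorem xorAt_target {ι : Type*} [Fintype ι] [DecidableEq ι] {c t : ι → Q}
    (ht : Function.Injective t) (x : Q → Fin 2) (i : ι) :
    xorAt c t x (t i) = x (t i) + x (c i) := by
  simp [xorAt, ht.eq_iff]

theorem xorAt_of_forall_ne {ι : Type*} [Fintype ι] {c t : ι → Q} (x : Q → Fin 2) {q : Q}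
    (hq : ∀ i, t i ≠ q) : xorAt c t x q = x q := by
  simp [xorAt, hq]

theorem run_cnots_ket [Fintype Q] {ι : Type*} (c t : ι → Q) (hct : ∀ i j, c i ≠ t j)
    (l : List ι) (x : Q → Fin 2) :
    run (l.map fun i => Gate.cnot (c i) (t i) (hct i i)) (ket x) =
      ket (fun q => x q + (l.map fun i => if t i = q then x (c i) else 0).sum) := by
  induction l generalizing x with
  | nil => simp
  | cons i l ih =>
    rw [List.map_cons, run_cons, cnot_apply_ket, ih]
    congr 1
    funext q
    simp only [List.map_cons, List.sum_cons, Function.update_of_ne (hct _ _)]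
    by_cases hq : t i = q
    · subst hq
      simp [add_assoc]
    · rw [Function.update_of_ne (Ne.symm hq), if_neg hq, zero_add]

/-- Injectivity of `c` and `t` puts all gates into one layer; as no control is a target, each gate
reads the original bit. -/
theorem maps_cnots [Fintype Q] {ι : Type*} [Fintype ι] (c t : ι → Q)
    (hc : Function.Injective c) (ht : Function.Injective t) (hct : ∀ i j, c i ≠ t j) :
    Maps 1 (fun x : Q → Fin 2 => ket x) (fun x => ket (xorAt c t x)) := by
  classical
  refine ⟨⟨[⟨(Finset.univ : Finset ι).toList.map fun i => Gate.cnot (c i) (t i) (hct i i),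
    ?_⟩]⟩, le_rfl, fun x => ?_⟩
  · rw [List.pairwise_map]
    refine (Finset.nodup_toList _).imp fun {i j} hij => ?_
    simp only [Gate.support, Finset.disjoint_insert_left, Finset.disjoint_singleton_left,
      Finset.mem_insert, Finset.mem_singleton, not_or]
    exact ⟨⟨hc.ne hij, hct i j⟩, fun h => hct j i h.symm, ht.ne hij⟩
  · refine (run_cnots_ket c t hct _ x).trans ?_
    congr 1
    funext q
    rw [Finset.sum_map_toList]
    rfl

theorem maps_cnot [Fintype Q] (c t : Q) (h : c ≠ t) :
    Maps 1 (fun x : Q → Fin 2 => ket x)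
      (fun x => ket (Function.update x t (x t + x c))) :=
  ⟨⟨[⟨[Gate.cnot c t h], by simp⟩]⟩, le_rfl, fun x => cnot_apply_ket c t h x⟩

theorem maps_single (q : Q) (U : Matrix.unitaryGroup (Fin 2) ℂ) :
    Maps 1 (fun ψ : Amplitudes Q => ψ) (fun ψ => (Gate.single q U).apply ψ) :=
  ⟨⟨[⟨[Gate.single q U], by simp⟩]⟩, le_rfl, fun _ => rfl⟩

theorem single_apply_ket [Fintype Q] (q : Q) (U : Matrix.unitaryGroup (Fin 2) ℂ)
    (x : Q → Fin 2) :
    (Gate.single q U).apply (ket x) = ∑ b, U.1 b (x q) • ket (Function.update x q b) := by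
  funext x'
  simp only [Gate.apply, Finset.sum_apply, Pi.smul_apply, smul_eq_mul, ket]
  by_cases h : ∀ p, p ≠ q → x' p = x p
  · have h1 : ∀ b, Function.update x' q b = x ↔ b = x q := by
      intro b
      constructor
      · rintro rfl
        simp
      · rintro rfl
        funext p
        by_cases hp : p = q
        · subst hp
          simp
        · rw [Function.update_of_ne hp, h p hp]
    have h2 : ∀ b, x' = Function.update x q b ↔ b = x' q := by
      intro b
      constructor
      · rintro rfl
        simp
      · rintro rfl
        funext p
        by_cases hp : p = q
        · subst hp
          simp
        · rw [Function.update_of_ne hp, h p hp]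
    simp [h1, h2]
  · push Not at h
    obtain ⟨p, hp, hne⟩ := h
    have h1 : ∀ b, Function.update x' q b ≠ x := by
      rintro b rfl
      exact hne (by rw [Function.update_of_ne hp])
    have h2 : ∀ b, x' ≠ Function.update x q b := by
      rintro b rfl
      exact hne (by rw [Function.update_of_ne hp])
    simp [h1, h2]

/-- Disjoint nonempty supports: choosing one qubit from each gate gives distinct qubits. -/
theorem Layer.length_gates_le [Fintype Q] (L : Layer Q) : L.gates.length ≤ Fintype.card Q := by
  obtain ⟨l, hl⟩ := L
  have key : ∀ l : List (Gate Q), l.Pairwise (fun g h => Disjoint g.support h.support) →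
      ∃ S : Finset Q, l.length ≤ S.card ∧ ∀ q ∈ S, ∃ g ∈ l, q ∈ g.support := by
    intro l hl
    induction l with
    | nil => exact ⟨∅, by simp⟩
    | cons g l ih =>
      obtain ⟨S, hS, hS'⟩ := ih (List.pairwise_cons.1 hl).2
      obtain ⟨q, hq⟩ : ∃ q, q ∈ g.support := by
        cases g with
        | single q U => exact ⟨q, by simp [Gate.support]⟩
        | cnot c t h => exact ⟨c, by simp [Gate.support]⟩
      refine ⟨insert q S, ?_, ?_⟩
      · rw [Finset.card_insert_of_notMem, List.length_cons]
        · omega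
        · intro hqS
          obtain ⟨h, hh, hqh⟩ := hS' q hqS
          exact Finset.disjoint_left.1 ((List.pairwise_cons.1 hl).1 h hh) hq hqh
      · intro p hp
        rcases Finset.mem_insert.1 hp with rfl | hp
        · exact ⟨g, by simp, hq⟩
        · obtain ⟨h, hh, hph⟩ := hS' p hp
          exact ⟨h, by simp [hh], hph⟩
  obtain ⟨S, hS, -⟩ := key l hl
  exact hS.trans (Finset.card_le_univ S)

theorem Circuit.size_le [Fintype Q] (C : Circuit Q) : C.size ≤ C.depth * Fintype.card Q := by
  obtain ⟨Ls⟩ := C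
  simp only [Circuit.size, Circuit.depth]
  have := List.sum_le_card_nsmul (Ls.map fun L => L.gates.length) (Fintype.card Q) (by
    intro n hn
    obtain ⟨L, -, rfl⟩ := List.mem_map.1 hn
    exact L.length_gates_le)
  simpa using this

end Basics

/-! ### Signs and characters -/

/-- The sign `(-1) ^ b`. -/
def sgn (b : Fin 2) : ℝ := if b = 0 then 1 else -1

/-- The character `(-1) ^ (a * b)`. -/
def chr (a b : Fin 2) : ℝ := if a = 0 then 1 else sgn b

theorem sgn_add (a b : Fin 2) : sgn (a + b) = sgn a * sgn b := by
  fin_cases a <;> fin_cases b <;> simp [sgn]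

theorem sgn_zero : sgn 0 = 1 := by simp [sgn]

theorem sgn_one : sgn 1 = -1 := by simp [sgn]

theorem chr_zero (b : Fin 2) : chr 0 b = 1 := by simp [chr]

theorem chr_one (b : Fin 2) : chr 1 b = sgn b := by simp [chr]

theorem chr_add_left (a a' b : Fin 2) : chr (a + a') b = chr a b * chr a' b := by
  fin_cases a <;> fin_cases a' <;> fin_cases b <;> simp [chr, sgn]

theorem sum_chr_mul_chr (b b' : Fin 2) :
    ∑ a, chr a b * chr a b' = if b = b' then 2 else 0 := by
  fin_cases b <;> fin_cases b' <;> simp [chr, sgn] <;> norm_num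

/-- Fourier inversion on bit strings. -/
theorem fourier_inversion {Q : Type} [Fintype Q] [DecidableEq Q] (f : (Q → Fin 2) → ℝ)
    (x : Q → Fin 2) :
    ∑ u : Q → Fin 2, ((2 : ℝ) ^ Fintype.card Q)⁻¹ * (∑ y, f y * ∏ q, chr (u q) (y q)) *
      ∏ q, chr (u q) (x q) = f x := by
  have key : ∀ y, ∑ u : Q → Fin 2, (∏ q, chr (u q) (y q)) * ∏ q, chr (u q) (x q) =
      if y = x then (2 : ℝ) ^ Fintype.card Q else 0 := by
    intro y
    have h1 : ∀ u : Q → Fin 2, (∏ q, chr (u q) (y q)) * ∏ q, chr (u q) (x q) =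
        ∏ q, chr (u q) (y q) * chr (u q) (x q) := fun u => Finset.prod_mul_distrib.symm
    have h2 := Finset.prod_univ_sum (fun _ : Q => (Finset.univ : Finset (Fin 2)))
      (fun q a => chr a (y q) * chr a (x q))
    rw [Fintype.piFinset_univ] at h2
    simp only [h1]
    rw [← h2]
    simp only [sum_chr_mul_chr]
    split_ifs with h
    · subst h
      simp
    · obtain ⟨q, hq⟩ := Function.ne_iff.1 h
      exact Finset.prod_eq_zero (Finset.mem_univ q) (if_neg hq)
  have h3 : ∀ u : Q → Fin 2, ((2 : ℝ) ^ Fintype.card Q)⁻¹ *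
      (∑ y, f y * ∏ q, chr (u q) (y q)) * ∏ q, chr (u q) (x q) =
      ∑ y, ((2 : ℝ) ^ Fintype.card Q)⁻¹ * f y *
        ((∏ q, chr (u q) (y q)) * ∏ q, chr (u q) (x q)) := by
    intro u
    rw [Finset.mul_sum, Finset.sum_mul]
    exact Finset.sum_congr rfl fun y _ => by ring
  simp only [h3]
  rw [Finset.sum_comm]
  simp only [← Finset.mul_sum, key]
  simp
  field_simp

theorem chr_self_inv : ∀ a : Fin 2, a + 1 + 1 = a := by decide

/-- A function that changes its sign with the bit `a` has no Fourier coefficients at frequencies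
without `a`. -/
theorem fourier_eq_zero_of_odd {Q : Type} [Fintype Q] [DecidableEq Q] (f : (Q → Fin 2) → ℝ)
    (a : Q) (hf : ∀ x, f (Function.update x a (x a + 1)) = -f x) (u : Q → Fin 2) (hu : u a = 0) :
    ∑ y, f y * ∏ q, chr (u q) (y q) = 0 := by
  have hinv : Function.Involutive (fun x : Q → Fin 2 => Function.update x a (x a + 1)) := by
    intro x
    simp [chr_self_inv]
  have h := Equiv.sum_comp (Function.Involutive.toPerm _ hinv)
    (fun y => f y * ∏ q, chr (u q) (y q))
  have h' : ∀ y, f (Function.Involutive.toPerm _ hinv y) *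
      ∏ q, chr (u q) (Function.Involutive.toPerm _ hinv y q) =
      -(f y * ∏ q, chr (u q) (y q)) := by
    intro y
    simp only [Function.Involutive.coe_toPerm, hf, neg_mul]
    congr 2
    refine Finset.prod_congr rfl fun q _ => ?_
    by_cases hq : q = a
    · subst hq
      rw [hu, chr_zero, chr_zero]
    · rw [Function.update_of_ne hq]
  simp only [h', Finset.sum_neg_distrib] at h
  linarith

/-! ### Diagonal operators -/

/-- The phase `exp (i θ)`. -/
noncomputable def phase (θ : ℝ) : ℂ := Complex.exp (θ * Complex.I)

theorem phase_add (θ φ : ℝ) : phase (θ + φ) = phase θ * phase φ := by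
  simp [phase, add_mul, Complex.exp_add]

theorem phase_zero : phase 0 = 1 := by simp [phase]

theorem star_phase (θ : ℝ) : star (phase θ) = phase (-θ) := by
  simp [phase, ← Complex.exp_conj]

theorem norm_phase (θ : ℝ) : ‖phase θ‖ = 1 := Complex.norm_exp_ofReal_mul_I θ

/-- The rotation `diag (exp (i α), exp (-i α))`. -/
noncomputable def rz (α : ℝ) : Matrix.unitaryGroup (Fin 2) ℂ :=
  ⟨Matrix.diagonal fun b => phase (α * sgn b), by
    rw [Matrix.mem_unitaryGroup_iff, Matrix.star_eq_conjTranspose,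
      Matrix.diagonal_conjTranspose, Matrix.diagonal_mul_diagonal, ← Matrix.diagonal_one]
    congr 1
    funext b
    rw [Pi.star_apply, star_phase, ← phase_add, add_neg_cancel, phase_zero]⟩

section Phases

variable {Q : Type} [DecidableEq Q] [Fintype Q]

/-- The diagonal operator with phases `Φ` is implemented in depth at most `d`. -/
def MapsPhase (d : ℕ) (Φ : (Q → Fin 2) → ℝ) : Prop :=
  Maps d (fun x => ket x) (fun x => phase (Φ x) • ket x)

theorem rz_apply_ket (q : Q) (α : ℝ) (x : Q → Fin 2) :
    (Gate.single q (rz α)).apply (ket x) = phase (α * sgn (x q)) • ket x := by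
  rw [single_apply_ket, Finset.sum_eq_single (x q)]
  · simp [rz]
  · intro b _ hb
    simp [rz, Matrix.diagonal_apply_ne _ hb]
  · simp

namespace MapsPhase

variable {d d' : ℕ} {Φ Ψ : (Q → Fin 2) → ℝ}

theorem trans (h : MapsPhase d Φ) (h' : MapsPhase d' Ψ) :
    MapsPhase (d + d') (fun x => Φ x + Ψ x) := by
  refine (Maps.trans h (h'.smul fun x => phase (Φ x))).congr (fun _ => rfl) fun x => ?_
  rw [smul_smul, phase_add]

theorem congr (h : MapsPhase d Φ) (hΦ : ∀ x, Φ x = Ψ x) : MapsPhase d Ψ := by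
  obtain rfl : Φ = Ψ := funext hΦ
  exact h

/-- Compute `E`, apply the phases to the image, uncompute `E`. Phases on parities thereby reduce to
phases on single qubits. -/
theorem conj {E : (Q → Fin 2) → (Q → Fin 2)} (hE : Maps d' (fun x => ket x) (fun x => ket (E x)))
    (h : MapsPhase d Φ) : MapsPhase (d' + d + d') (fun x => Φ (E x)) :=
  (hE.trans (Maps.comp h E)).trans (hE.symm.smul fun x => phase (Φ (E x)))

theorem zero : MapsPhase 0 (fun _ : Q → Fin 2 => 0) :=
  (Maps.refl _).congr (fun _ => rfl) fun x => by simp [phase_zero]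

theorem sum {κ : Type*} (S : Finset κ) (Φ : κ → (Q → Fin 2) → ℝ)
    (h : ∀ k ∈ S, MapsPhase d (Φ k)) : MapsPhase (S.card * d) (fun x => ∑ k ∈ S, Φ k x) := by
  classical
  induction S using Finset.induction_on with
  | empty => exact (zero.congr fun x => by simp).mono (by simp)
  | insert k S hk ih =>
    refine (((h k (by simp)).trans (ih fun k' hk' => h k' (by simp [hk']))).congr
      fun x => ?_).mono ?_
    · rw [Finset.sum_insert hk]
    · rw [Finset.card_insert_of_notMem hk, add_mul, one_mul, add_comm]

end MapsPhase

theorem mapsPhase_layer {ι : Type*} [Fintype ι] (t : ι → Q) (ht : Function.Injective t)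
    (α : ι → ℝ) : MapsPhase 1 (fun x : Q → Fin 2 => ∑ i, α i * sgn (x (t i))) := by
  classical
  refine ⟨⟨[⟨(Finset.univ : Finset ι).toList.map fun i => Gate.single (t i) (rz (α i)),
    ?_⟩]⟩, le_rfl, fun x => ?_⟩
  · rw [List.pairwise_map]
    refine (Finset.nodup_toList _).imp fun {i j} hij => ?_
    simp [Gate.support, ht.ne hij]
  · have key : ∀ l : List ι, run (l.map fun i => Gate.single (t i) (rz (α i))) (ket x) =
        phase (l.map fun i => α i * sgn (x (t i))).sum • ket x := by
      intro l
      induction l with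
      | nil => simp [phase_zero]
      | cons i l ih =>
        rw [List.map_cons, run_cons, rz_apply_ket, run_smul, ih, smul_smul, List.map_cons,
          List.sum_cons, phase_add]
    refine (key _).trans ?_
    rw [Finset.sum_map_toList]

/-- Phases on all parities of the target bits with subsets of their control bits. -/
theorem mapsPhase_walk {ι : Type*} [Fintype ι] [DecidableEq ι] (t : ι → Q)
    (ht : Function.Injective t) (q : ℕ) (c : ι → Fin q → Q)
    (hc : ∀ k, Function.Injective fun i => c i k) (hct : ∀ i k j, c i k ≠ t j)
    (α : ι → (Fin q → Fin 2) → ℝ) :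
    MapsPhase (3 * 2 ^ q - 2) (fun x : Q → Fin 2 =>
      ∑ i, ∑ w, α i w * (sgn (x (t i)) * ∏ k, chr (w k) (x (c i k)))) := by
  induction q with
  | zero =>
    refine ((mapsPhase_layer t ht fun i => α i default).congr fun x => ?_).mono (by simp)
    simp only [Finset.univ_eq_empty, Finset.prod_empty, mul_one, Fintype.sum_unique]
    congr!
  | succ q ih =>
    -- Frequencies are split by their first bit: those with bit 1 are treated between two copies of
    -- this layer of CNOTs. The depth satisfies T(0) = 1 and T(q+1) = 2T(q) + 2, hence 3·2^q - 2.
    have hK : Maps 1 (fun x : Q → Fin 2 => ket x)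
        (fun x => ket (xorAt (fun i => c i 0) t x)) :=
      maps_cnots _ t (hc 0) ht fun i j => hct i 0 j
    have h0 := ih (fun i k => c i k.succ) (fun k => hc k.succ) (fun i k j => hct i _ j)
      (fun i w => α i (Fin.cons 0 w))
    have h1 := ih (fun i k => c i k.succ) (fun k => hc k.succ) (fun i k j => hct i _ j)
      (fun i w => α i (Fin.cons 1 w))
    refine ((h0.trans (MapsPhase.conj hK h1)).congr fun x => ?_).mono ?_
    · rw [← Finset.sum_add_distrib]
      refine Finset.sum_congr rfl fun i _ => ?_
      rw [← (Fin.consEquiv fun _ => Fin 2).sum_comp, Fintype.sum_prod_type, Fin.sum_univ_two]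
      congr 1
      · refine Finset.sum_congr rfl fun w _ => ?_
        simp [Fin.consEquiv, Fin.prod_univ_succ, chr_zero]
      · refine Finset.sum_congr rfl fun w _ => ?_
        rw [xorAt_target ht, sgn_add]
        simp only [xorAt_of_forall_ne x fun j => (hct i _ j).symm]
        simp only [Fin.consEquiv, Equiv.coe_fn_mk, Fin.prod_univ_succ, Fin.cons_zero,
          Fin.cons_succ, chr_one]
        ring
    · have : 1 ≤ 2 ^ q := Nat.one_le_two_pow
      rw [pow_succ]
      omega

/-! ### Serial CNOT gates -/

theorem maps_gather_serial (a : Q) (l : List Q) (ha : a ∉ l) :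
    Maps l.length (fun x : Q → Fin 2 => ket x)
      (fun x => ket (Function.update x a (x a + (l.map x).sum))) := by
  induction l with
  | nil => exact (Maps.refl _).congr (fun _ => rfl) fun x => by simp
  | cons q l ih =>
    rw [List.mem_cons, not_or] at ha
    refine (((maps_cnot q a (Ne.symm ha.1)).trans ((ih ha.2).comp _)).congr (fun _ => rfl)
      fun x => ?_).mono (by simp [add_comm])
    congr 1
    simp only [Function.update_self, Function.update_idem, List.map_cons, List.sum_cons]
    have : l.map (Function.update x a (x a + x q)) = l.map x :=
      List.map_congr_left fun p hp => Function.update_of_ne (ne_of_mem_of_not_mem hp ha.2) _ _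
    rw [this, add_assoc]

theorem maps_fanout_serial (a : Q) (l : List Q) (ha : a ∉ l) (hl : l.Nodup) :
    Maps l.length (fun x : Q → Fin 2 => ket x)
      (fun x => ket (fun q => if q ∈ l then x q + x a else x q)) := by
  induction l with
  | nil => exact (Maps.refl _).congr (fun _ => rfl) fun x => by simp
  | cons q l ih =>
    rw [List.mem_cons, not_or] at ha
    rw [List.nodup_cons] at hl
    refine (((maps_cnot a q ha.1).trans ((ih ha.2 hl.2).comp _)).congr (fun _ => rfl)
      fun x => ?_).mono (by simp [add_comm])
    congr 1
    funext p
    by_cases hp : p = q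
    · subst hp
      simp [hl.1]
    · simp [hp, Function.update_of_ne ha.1]

end Phases

/-! ### Hamming codes -/

section Hamming

variable {B : Type} [Fintype B] [DecidableEq B] [AddCommGroup B]

/-- The syndrome of a bit string indexed by an elementary abelian 2-group. -/
def syndrome (v : B → Fin 2) : B := ∑ i, if v i = 1 then i else 0

/-- The bit string `v` with its `i`-th bit flipped, unless `i = 0`. -/
def flipAt (i : B) (v : B → Fin 2) : B → Fin 2 :=
  if i = 0 then v else Function.update v i (v i + 1)

theorem flipAt_flipAt (i : B) (v : B → Fin 2) : flipAt i (flipAt i v) = v := by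
  unfold flipAt
  split_ifs with h
  · rfl
  · simp [chr_self_inv]

theorem flipAt_zero (i : B) (v : B → Fin 2) : flipAt i v 0 = v 0 := by
  unfold flipAt
  split_ifs with h
  · rfl
  · rw [Function.update_of_ne (Ne.symm h)]

theorem syndrome_flipAt (hB : ∀ i : B, i + i = 0) (i : B) (v : B → Fin 2) :
    syndrome (flipAt i v) = syndrome v + i := by
  unfold flipAt
  split_ifs with h
  · rw [h, add_zero]
  · unfold syndrome
    rw [← Finset.add_sum_erase _ _ (Finset.mem_univ i),
      ← Finset.add_sum_erase (a := i) _ _ (Finset.mem_univ i)]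
    have h1 : ∑ x ∈ Finset.univ.erase i,
        (if Function.update v i (v i + 1) x = 1 then x else 0) =
        ∑ x ∈ Finset.univ.erase i, if v x = 1 then x else 0 := by
      refine Finset.sum_congr rfl fun x hx => ?_
      rw [Function.update_of_ne (Finset.ne_of_mem_erase hx)]
    rw [h1, Function.update_self]
    have h2 : v i = 0 ∨ v i = 1 := by
      generalize v i = b
      revert b
      decide
    rcases h2 with h2 | h2
    · simp [h2, add_comm]
    · simp only [h2, Fin.isValue, if_true]
      rw [if_neg (by decide), add_right_comm, hB]

variable (B) in
/-- The words of syndrome zero with a one at position zero. -/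
def code : Finset (B → Fin 2) := {v | v 0 = 1 ∧ syndrome v = 0}

/-- The Hamming code is perfect: flipping bit `i` shifts the syndrome by `i`, so `s` lies in the
ball of exactly one code word, found by flipping `s` at its own syndrome. Position zero is never
flipped, since `i = 0` stands for the centre of the ball. -/
theorem sum_code_flipAt {M : Type*} [AddCommMonoid M] (hB : ∀ i : B, i + i = 0)
    (F : (B → Fin 2) → M) :
    ∑ v ∈ code B, ∑ i, F (flipAt i v) = ∑ s with s 0 = 1, F s := by
  rw [← Finset.sum_product']
  refine Finset.sum_bij' (fun p _ => flipAt p.2 p.1)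
    (fun s _ => (flipAt (syndrome s) s, syndrome s)) ?_ ?_ ?_ ?_ ?_
  · intro p hp
    simp only [code, Finset.mem_product, Finset.mem_filter, Finset.mem_univ, true_and,
      and_true] at hp ⊢
    rw [flipAt_zero, hp.1]
  · intro s hs
    simp only [code, Finset.mem_product, Finset.mem_filter, Finset.mem_univ, true_and,
      and_true] at hs ⊢
    exact ⟨by rw [flipAt_zero, hs], by rw [syndrome_flipAt hB, hB]⟩
  · intro p hp
    simp only [code, Finset.mem_product, Finset.mem_filter, Finset.mem_univ, true_and,
      and_true] at hp
    have h := syndrome_flipAt hB p.2 p.1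
    rw [hp.2, zero_add] at h
    refine Prod.ext ?_ h
    simp only [h, flipAt_flipAt]
  · intro s hs
    simp [flipAt_flipAt]
  · intro p hp
    rfl

theorem card_filter_apply_zero : Finset.card {s : B → Fin 2 | s 0 = 1} * 2 = 2 ^ Fintype.card B := by
  have h : ({s : B → Fin 2 | s 0 = 1} : Finset _) =
      Fintype.piFinset fun i : B => if i = 0 then {1} else Finset.univ := by
    ext s
    simp only [Finset.mem_filter, Finset.mem_univ, true_and, Fintype.mem_piFinset]
    constructor
    · intro h i
      split_ifs with hi
      · simp [hi, h]
      · simp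
    · intro h
      simpa using h 0
  rw [h, Fintype.card_piFinset, ← Finset.mul_prod_erase _ _ (Finset.mem_univ (0 : B))]
  have : ∏ x ∈ Finset.univ.erase (0 : B),
      (if x = 0 then ({1} : Finset (Fin 2)) else Finset.univ).card = 2 ^ (Fintype.card B - 1) := by
    rw [Finset.prod_congr rfl (g := fun _ => 2) fun x hx => by
      rw [if_neg (Finset.ne_of_mem_erase hx)]; rfl]
    simp
  rw [this]
  simp only [if_true, Finset.card_singleton, one_mul]
  rw [← pow_succ, Nat.sub_add_cancel Fintype.card_pos]

theorem card_code (hB : ∀ i : B, i + i = 0) :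
    (code B).card * Fintype.card B * 2 = 2 ^ Fintype.card B := by
  rw [← card_filter_apply_zero, Finset.card_eq_sum_ones {s : B → Fin 2 | s 0 = 1},
    ← sum_code_flipAt hB]
  simp

end Hamming

/-! ### Multiplexed rotations -/

section Multiplexer

variable {B : Type} [Fintype B] [DecidableEq B] [AddCommGroup B] {p : ℕ}

/-- The linear map that adds the parity `v` of the target bits to all target bits except the
zeroth one, which it replaces by that parity. -/
def addParity (v : B → Fin 2) (x : B ⊕ Fin p → Fin 2) : B ⊕ Fin p → Fin 2 :=
  fun q => match q with
    | Sum.inl i => (if i = 0 then 0 else x (Sum.inl i)) +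
        ∑ k, if v k = 1 then x (Sum.inl k) else 0
    | Sum.inr k => x (Sum.inr k)

/-- Since `v 0 = 1`, the parity can be gathered in place at position zero, and then fanned out to
the rest of the block. -/
theorem maps_addParity (v : B → Fin 2) (hv : v 0 = 1) :
    Maps (2 * Fintype.card B) (fun x : B ⊕ Fin p → Fin 2 => ket x)
      (fun x => ket (addParity v x)) := by
  set l₁ : List (B ⊕ Fin p) :=
    (({i : B | i ≠ 0 ∧ v i = 1} : Finset B).toList).map Sum.inl with hl₁
  set l₂ : List (B ⊕ Fin p) := (({i : B | i ≠ 0} : Finset B).toList).map Sum.inl with hl₂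
  have h₁ : (Sum.inl 0 : B ⊕ Fin p) ∉ l₁ := by simp [hl₁]
  have h₂ : (Sum.inl 0 : B ⊕ Fin p) ∉ l₂ := by simp [hl₂]
  have hn : l₂.Nodup := (Finset.nodup_toList _).map Sum.inl_injective
  refine (((maps_gather_serial _ l₁ h₁).trans
    ((maps_fanout_serial _ l₂ h₂ hn).comp _)).congr (fun _ => rfl) fun x => ?_).mono ?_
  · congr 1
    have hs : x (Sum.inl 0) + (l₁.map x).sum = ∑ k, if v k = 1 then x (Sum.inl k) else 0 := by
      rw [hl₁, List.map_map, Finset.sum_map_toList, Finset.sum_filter,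
        ← Finset.add_sum_erase Finset.univ (fun k => if v k = 1 then x (Sum.inl k) else 0)
          (Finset.mem_univ 0), if_pos hv,
        ← Finset.add_sum_erase Finset.univ _ (Finset.mem_univ (0 : B))]
      simp only [ne_eq, not_true_eq_false, false_and, if_false, zero_add]
      congr 1
      refine Finset.sum_congr rfl fun k hk => ?_
      simp [Finset.ne_of_mem_erase hk]
    funext q
    rcases q with i | k
    · by_cases hi : i = 0
      · subst hi
        simp only [h₂, if_false, addParity, if_true, Function.update_self, hs, zero_add]
      · have : (Sum.inl i : B ⊕ Fin p) ∈ l₂ := by simp [hl₂, hi]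
        simp only [this, if_true, addParity, hi, if_false, Function.update_self, hs]
        rw [Function.update_of_ne (by simpa using hi)]
    · have : (Sum.inr k : B ⊕ Fin p) ∉ l₂ := by simp [hl₂]
      simp [this, addParity]
  · have e₁ : l₁.length ≤ Fintype.card B := by
      simpa [hl₁] using Finset.card_le_univ ({i : B | i ≠ 0 ∧ v i = 1} : Finset B)
    have e₂ : l₂.length ≤ Fintype.card B := by
      simpa [hl₂] using Finset.card_le_univ ({i : B | i ≠ 0} : Finset B)
    omega

theorem sgn_sum {ι : Type*} (s : Finset ι) (f : ι → Fin 2) :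
    sgn (∑ i ∈ s, f i) = ∏ i ∈ s, sgn (f i) := by
  classical
  induction s using Finset.induction_on with
  | empty => simp [sgn_zero]
  | insert i s hi ih => rw [Finset.sum_insert hi, Finset.prod_insert hi, sgn_add, ih]

/-- The block then holds the whole Hamming ball around `v`: adding the parity `v` to bit `i` yields
the parity of `v` with `i` flipped, and position zero holds `v` itself. -/
theorem sgn_addParity (v : B → Fin 2) (x : B ⊕ Fin p → Fin 2) (i : B) :
    sgn (addParity v x (Sum.inl i)) = ∏ k, chr (flipAt i v k) (x (Sum.inl k)) := by
  have h1 : sgn (∑ k, if v k = 1 then x (Sum.inl k) else 0) = ∏ k, chr (v k) (x (Sum.inl k)) := by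
    rw [sgn_sum]
    refine Finset.prod_congr rfl fun k _ => ?_
    generalize v k = a
    fin_cases a
    · simp [chr, sgn_zero]
    · simp [chr]
  simp only [addParity, sgn_add, h1, flipAt]
  by_cases hi : i = 0
  · simp [hi, sgn_zero]
  · simp only [hi, if_false]
    rw [← Finset.mul_prod_erase _ (fun k => chr (v k) (x (Sum.inl k))) (Finset.mem_univ i),
      ← Finset.mul_prod_erase _ (fun k => chr (Function.update v i (v i + 1) k) (x (Sum.inl k)))
        (Finset.mem_univ i), Function.update_self, chr_add_left, chr_one, ← mul_assoc]
    congr 1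
    · ring
    · refine Finset.prod_congr rfl fun k hk => ?_
      rw [Function.update_of_ne (Finset.ne_of_mem_erase hk)]

/-- The multiplexed rotation about the `z`-axis of the target at position zero. -/
theorem mapsPhase_multiplexed_of_perm (hB : ∀ i : B, i + i = 0) (σ : B → Equiv.Perm (Fin p))
    (hσ : ∀ k, Function.Injective fun i => σ i k) (f : (B ⊕ Fin p → Fin 2) → ℝ)
    (hf : ∀ x, f (Function.update x (Sum.inl 0) (x (Sum.inl 0) + 1)) = -f x) :
    MapsPhase ((code B).card * (4 * Fintype.card B + 3 * 2 ^ p)) f := by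
  -- The Fourier coefficients of `f`.
  set g : (B ⊕ Fin p → Fin 2) → ℝ := fun u =>
    ((2 : ℝ) ^ Fintype.card (B ⊕ Fin p))⁻¹ * (∑ y, f y * ∏ q, chr (u q) (y q)) with hg
  have hwalk : ∀ v ∈ code B, MapsPhase (4 * Fintype.card B + 3 * 2 ^ p)
      (fun x : B ⊕ Fin p → Fin 2 => ∑ i, ∑ w, g (Sum.elim (flipAt i v) w) *
        ((∏ k, chr (flipAt i v k) (x (Sum.inl k))) * ∏ k, chr (w k) (x (Sum.inr k)))) := by
    intro v hv
    simp only [code, Finset.mem_filter, Finset.mem_univ, true_and] at hv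
    -- Block qubit `i` visits the controls in the order `σ i`, so at each step distinct block qubits
    -- use distinct controls; its coefficients are reindexed to match.
    have h := mapsPhase_walk (Sum.inl : B → B ⊕ Fin p) Sum.inl_injective p
      (fun i k => Sum.inr (σ i k)) (fun k => Sum.inr_injective.comp (hσ k)) (by simp)
      (fun i w => g (Sum.elim (flipAt i v) (w ∘ (σ i).symm)))
    refine ((MapsPhase.conj (maps_addParity v hv.1) h).congr fun x => ?_).mono ?_
    · refine Finset.sum_congr rfl fun i _ => ?_
      rw [← ((σ i).symm.arrowCongr (Equiv.refl (Fin 2))).sum_comp]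
      refine Finset.sum_congr rfl fun w _ => ?_
      rw [sgn_addParity, ← Equiv.prod_comp (σ i) (fun k => chr (w k) (x (Sum.inr k)))]
      congr 3
      · funext k
        simp [Equiv.arrowCongr]
    · omega
  refine (MapsPhase.sum (code B) _ hwalk).congr fun x => ?_
  -- The balls around code words exhaust the frequencies containing the target; the remaining
  -- coefficients vanish because `f` is odd in that bit.
  rw [sum_code_flipAt hB (fun s => ∑ w, g (Sum.elim s w) *
    ((∏ k, chr (s k) (x (Sum.inl k))) * ∏ k, chr (w k) (x (Sum.inr k)))), Finset.sum_filter,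
    ← fourier_inversion f x, ← (Equiv.sumArrowEquivProdArrow B (Fin p) (Fin 2)).symm.sum_comp,
    Fintype.sum_prod_type]
  refine Finset.sum_congr rfl fun s _ => ?_
  split_ifs with hs
  · refine Finset.sum_congr rfl fun w _ => ?_
    simp only [hg, Fintype.prod_sum_type]
    rfl
  · symm
    refine Finset.sum_eq_zero fun w _ => ?_
    rw [fourier_eq_zero_of_odd f (Sum.inl 0) hf, mul_zero, zero_mul]
    have : ∀ b : Fin 2, ¬ b = 1 → b = 0 := by decide
    exact this _ hs

end Multiplexer

/-! ### Renaming qubits -/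

section Relabel

variable {Q Q' : Type} [DecidableEq Q] [DecidableEq Q']

/-- The state `ψ` after renaming the qubits. -/
def relabel (e : Q ≃ Q') (ψ : Amplitudes Q) : Amplitudes Q' := fun x => ψ (x ∘ e)

theorem extend_equiv (e : Q ≃ Q') (ψ : Amplitudes Q) (x : Q' → Fin 2) :
    extend e.toEmbedding ψ x = relabel e ψ := by
  funext x'
  rw [extend, if_pos]
  · rfl
  · intro p hp
    exact absurd ⟨e.symm p, e.apply_symm_apply p⟩ hp

theorem relabel_ket [Fintype Q] [Fintype Q'] (e : Q ≃ Q') (u : Q → Fin 2) :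
    relabel e (ket u) = ket (u ∘ e.symm) := by
  rw [← extend_equiv e _ 0]
  refine extend_ket _ _ _ _ (fun q => by simp) fun p hp => ?_
  exact absurd ⟨e.symm p, e.apply_symm_apply p⟩ hp

theorem relabel_smul (e : Q ≃ Q') (a : ℂ) (ψ : Amplitudes Q) :
    relabel e (a • ψ) = a • relabel e ψ := rfl

theorem relabel_sum {ι : Type*} (e : Q ≃ Q') (s : Finset ι) (ψ : ι → Amplitudes Q) :
    relabel e (∑ i ∈ s, ψ i) = ∑ i ∈ s, relabel e (ψ i) := by
  funext x
  simp [relabel, Finset.sum_apply]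

theorem Maps.relabel {ι : Type*} {d : ℕ} {s t : ι → Amplitudes Q} (h : Maps d s t)
    (e : Q ≃ Q') : Maps d (fun i => QSP.relabel e (s i)) (fun i => QSP.relabel e (t i)) :=
  ((h.extend e.toEmbedding).comp fun i => (i, 0)).congr (fun _ => extend_equiv e _ _)
    fun _ => extend_equiv e _ _

theorem MapsPhase.relabel [Fintype Q] [Fintype Q'] {d : ℕ} {Φ : (Q → Fin 2) → ℝ}
    (h : MapsPhase d Φ) (e : Q ≃ Q') : MapsPhase d (fun x : Q' → Fin 2 => Φ (x ∘ e)) := by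
  refine ((Maps.relabel h e).comp fun x : Q' → Fin 2 => x ∘ e).congr (fun x => ?_) fun x => ?_
  · rw [relabel_ket]
    congr 1
    funext q
    simp
  · rw [relabel_smul, relabel_ket]
    congr 2
    funext q
    simp

end Relabel

/-- A rotation about the `z`-axis of the qubit `a`, multiplexed by all other qubits. -/
theorem exists_mapsPhase_multiplexed {Q : Type} [Fintype Q] [DecidableEq Q] (a : Q)
    (f : (Q → Fin 2) → ℝ) (hf : ∀ x, f (Function.update x a (x a + 1)) = -f x) :
    ∃ D, D * Fintype.card Q ≤ 14 * 2 ^ Fintype.card Q ∧ MapsPhase D f := by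
  -- The block has to be a constant fraction of all qubits, to gain a factor of order N, and at most
  -- half of them, to leave a separate control for each block qubit. A single qubit is the
  -- exceptional case.
  obtain ⟨b, p, hN, hbp, hp⟩ : ∃ b p, 2 ^ b + p = Fintype.card Q ∧
      Fintype.card Q ≤ 4 * 2 ^ b ∧ ((p = 0 ∧ b = 0) ∨ 2 ^ b ≤ p) := by
    have hpos : 0 < Fintype.card Q := Fintype.card_pos_iff.2 ⟨a⟩
    by_cases h1 : Fintype.card Q = 1
    · exact ⟨0, 0, by simp [h1], by simp [h1], Or.inl ⟨rfl, rfl⟩⟩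
    · have h2 : Fintype.card Q / 2 ≠ 0 := by omega
      have e1 := Nat.pow_log_le_self 2 h2
      have e2 := Nat.lt_pow_succ_log_self (b := 2) (by norm_num) (Fintype.card Q / 2)
      rw [pow_succ] at e2
      exact ⟨Nat.log 2 (Fintype.card Q / 2),
        Fintype.card Q - 2 ^ Nat.log 2 (Fintype.card Q / 2), by omega, by omega,
        Or.inr (by omega)⟩
  have hB : ∀ i : Fin b → Fin 2, i + i = 0 := by
    intro i
    funext k
    have : ∀ c : Fin 2, c + c = 0 := by decide
    exact this _
  have hcB : Fintype.card (Fin b → Fin 2) = 2 ^ b := by simp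
  obtain ⟨σ, hσ⟩ : ∃ σ : (Fin b → Fin 2) → Equiv.Perm (Fin p),
      ∀ k, Function.Injective fun i => σ i k := by
    rcases hp with ⟨rfl, rfl⟩ | hp
    · exact ⟨fun _ => Equiv.refl _, fun k => k.elim0⟩
    · have : NeZero p := ⟨by have := Nat.one_le_two_pow (n := b); omega⟩
      obtain ⟨g⟩ : Nonempty ((Fin b → Fin 2) ↪ Fin p) :=
        Function.Embedding.nonempty_of_card_le (by rw [hcB, Fintype.card_fin]; exact hp)
      -- Cyclic shifts of the controls by distinct amounts never agree at any position.
      exact ⟨fun i => Equiv.addRight (g i), fun k i j hij =>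
        g.injective (add_left_cancel hij)⟩
  obtain ⟨e, he⟩ : ∃ e : (Fin b → Fin 2) ⊕ Fin p ≃ Q, e (Sum.inl 0) = a := by
    have hcard : Fintype.card ((Fin b → Fin 2) ⊕ Fin p) = Fintype.card Q := by
      rw [Fintype.card_sum, hcB, Fintype.card_fin, hN]
    let e := Fintype.equivOfCardEq hcard
    exact ⟨e.trans (Equiv.swap (e (Sum.inl 0)) a), by simp⟩
  have h := mapsPhase_multiplexed_of_perm hB σ hσ (fun x => f (x ∘ e.symm)) (by
    intro x
    rw [← hf]
    congr 1
    have ha : e.symm a = Sum.inl 0 := by rw [← he, e.symm_apply_apply]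
    funext q
    by_cases hq : q = a
    · subst hq
      simp [ha]
    · have : e.symm q ≠ Sum.inl 0 := by
        rw [← ha]
        exact e.symm.injective.ne hq
      simp [Function.update_of_ne hq, Function.update_of_ne this])
  refine ⟨_, ?_, (h.relabel e).congr fun x => ?_⟩
  -- The constant is 7·4/2: 4·2^b + 3·2^p ≤ 7·2^p for one code word, N ≤ 4·2^b, and there are
  -- 2^|B|/(2|B|) code words.
  · have hcode := card_code hB
    rw [hcB] at hcode ⊢
    rw [← hN] at hbp ⊢
    have hpow : 2 ^ 2 ^ b * 2 ^ p = 2 ^ (2 ^ b + p) := (pow_add _ _ _).symm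
    have hle : 4 * 2 ^ b + 3 * 2 ^ p ≤ 7 * 2 ^ p := by
      rcases hp with ⟨rfl, rfl⟩ | hp
      · norm_num
      · have := (Nat.lt_two_pow_self (n := p)).le
        omega
    calc (code (Fin b → Fin 2)).card * (4 * 2 ^ b + 3 * 2 ^ p) * (2 ^ b + p)
        ≤ (code (Fin b → Fin 2)).card * (7 * 2 ^ p) * (4 * 2 ^ b) := by gcongr
      _ = 14 * ((code (Fin b → Fin 2)).card * 2 ^ b * 2 * 2 ^ p) := by ring
      _ = 14 * 2 ^ (2 ^ b + p) := by rw [hcode, hpow]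
  · congr 1
    funext q
    simp

/-! ### Preparing one more qubit -/

/-- The Hadamard matrix. -/
noncomputable def hadamard : Matrix.unitaryGroup (Fin 2) ℂ :=
  ⟨((√2 : ℝ) : ℂ)⁻¹ • !![1, 1; 1, -1], by
    have h : ((√2 : ℝ) : ℂ) * ((√2 : ℝ) : ℂ) = 2 := by
      rw [← Complex.ofReal_mul, Real.mul_self_sqrt (by norm_num)]
      norm_num
    have h0 : ((√2 : ℝ) : ℂ)⁻¹ * ((√2 : ℝ) : ℂ)⁻¹ = 2⁻¹ := by rw [← mul_inv, h]
    rw [Matrix.mem_unitaryGroup_iff]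
    ext i j
    fin_cases i <;> fin_cases j <;>
      simp [Matrix.mul_apply, Fin.sum_univ_two, Matrix.star_apply, h0] <;> norm_num⟩

/-- The matrix that maps `|0⟩ ± |1⟩` to real multiples of `|0⟩` and to `∓ i |1⟩`. -/
noncomputable def yBasis : Matrix.unitaryGroup (Fin 2) ℂ :=
  ⟨((√2 : ℝ) : ℂ)⁻¹ • !![1, 1; -Complex.I, Complex.I], by
    have h : ((√2 : ℝ) : ℂ) * ((√2 : ℝ) : ℂ) = 2 := by
      rw [← Complex.ofReal_mul, Real.mul_self_sqrt (by norm_num)]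
      norm_num
    have h0 : ((√2 : ℝ) : ℂ)⁻¹ * ((√2 : ℝ) : ℂ)⁻¹ = 2⁻¹ := by rw [← mul_inv, h]
    have h1 : Complex.I * ((√2 : ℝ) : ℂ)⁻¹ * (Complex.I * ((√2 : ℝ) : ℂ)⁻¹) = -2⁻¹ := by
      rw [mul_mul_mul_comm, h0, Complex.I_mul_I]
      norm_num
    rw [Matrix.mem_unitaryGroup_iff]
    ext i j
    fin_cases i <;> fin_cases j <;>
      simp [Matrix.mul_apply, Fin.sum_univ_two, Matrix.star_apply, h0, mul_comm _ Complex.I, h1]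
      <;> norm_num⟩

section Append

variable {Q : Type} [Fintype Q] [DecidableEq Q]

/-- The bit string `x` with the bit `b` appended. -/
def app (x : Q → Fin 2) (b : Fin 2) : Q ⊕ Unit → Fin 2 := Sum.elim x fun _ => b

theorem update_app (x : Q → Fin 2) (b b' : Fin 2) :
    Function.update (app x b) (Sum.inr ()) b' = app x b' := by
  funext q
  rcases q with q | u
  · simp [app]
  · simp [app]

theorem phase_add_phase_neg (θ : ℝ) : phase θ + phase (-θ) = 2 * (Real.cos θ : ℂ) := by
  simp only [phase, Complex.ofReal_neg, Complex.ofReal_cos, Complex.cos]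
  ring

theorem phase_sub_phase_neg (θ : ℝ) :
    phase θ - phase (-θ) = 2 * Complex.I * (Real.sin θ : ℂ) := by
  simp only [phase, Complex.ofReal_neg, Complex.ofReal_sin, Complex.sin]
  linear_combination (-(Complex.exp (-(θ : ℂ) * Complex.I) - Complex.exp (θ * Complex.I))) *
    Complex.I_mul_I

/-- A multiplexed rotation about the `y`-axis of a qubit in the state `|0⟩`. -/
theorem exists_maps_rotation (θ : (Q → Fin 2) → ℝ) :
    ∃ D, D * (Fintype.card Q + 1) ≤ 28 * 2 ^ Fintype.card Q + 2 * (Fintype.card Q + 1) ∧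
      Maps D (fun x : Q → Fin 2 => ket (app x 0))
        (fun x => (Real.cos (θ x) : ℂ) • ket (app x 0) + (Real.sin (θ x) : ℂ) • ket (app x 1)) := by
  obtain ⟨D, hD, h⟩ := exists_mapsPhase_multiplexed (Sum.inr () : Q ⊕ Unit)
    (fun x => sgn (x (Sum.inr ())) * θ (fun q => x (Sum.inl q))) (by
      intro x
      simp [sgn_add, sgn_one])
  rw [Fintype.card_sum, Fintype.card_unit, pow_succ] at hD
  have hs : ((√2 : ℝ) : ℂ)⁻¹ * ((√2 : ℝ) : ℂ)⁻¹ = 2⁻¹ := by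
    rw [← mul_inv, ← Complex.ofReal_mul, Real.mul_self_sqrt (by norm_num)]
    norm_num
  refine ⟨1 + D + 1, by nlinarith, ?_⟩
  -- The Hadamard gate creates both branches, the diagonal operator gives them the phases ±θ, and
  -- `yBasis` turns the sum and difference of these phases into cosine and sine.
  have h1 : Maps 1 (fun x : Q → Fin 2 => ket (app x 0))
      (fun x => ∑ b, ((√2 : ℝ) : ℂ)⁻¹ • ket (app x b)) := by
    refine ((maps_single (Sum.inr () : Q ⊕ Unit) hadamard).comp
      fun x : Q → Fin 2 => ket (app x 0)).congr (fun _ => rfl) fun x => ?_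
    rw [single_apply_ket]
    refine Finset.sum_congr rfl fun b _ => ?_
    rw [update_app]
    congr 1
    fin_cases b <;> simp [hadamard, app]
  have h2 := Maps.sum (fun _ : Q → Fin 2 => (Finset.univ : Finset (Fin 2)))
    (fun x b => app x b) (fun _ _ => ((√2 : ℝ) : ℂ)⁻¹) h
  refine (h1.trans h2).trans (((maps_single (Sum.inr () : Q ⊕ Unit) yBasis).comp
    fun x : Q → Fin 2 => _).congr (fun _ => rfl) fun x => ?_)
  simp only [Fin.sum_univ_two, Gate.apply_add, Gate.apply_smul, single_apply_ket, update_app]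
  have a0 : app x 0 (Sum.inr ()) = 0 := rfl
  have a1 : app x 1 (Sum.inr ()) = 1 := rfl
  have a2 : ∀ b, (fun q => app x b (Sum.inl q)) = x := fun b => rfl
  simp only [a0, a1, a2, sgn_zero, sgn_one, one_mul, neg_one_mul]
  have c : (Real.cos (θ x) : ℂ) = 2⁻¹ * (phase (θ x) + phase (-θ x)) := by
    rw [phase_add_phase_neg]
    ring
  have s : (Real.sin (θ x) : ℂ) = 2⁻¹ * (-Complex.I) * (phase (θ x) - phase (-θ x)) := by
    rw [phase_sub_phase_neg]
    linear_combination (Real.sin (θ x) : ℂ) * Complex.I_mul_I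
  rw [c, s, ← hs]
  have y00 : yBasis.1 0 0 = ((√2 : ℝ) : ℂ)⁻¹ := by simp [yBasis]
  have y01 : yBasis.1 0 1 = ((√2 : ℝ) : ℂ)⁻¹ := by simp [yBasis]
  have y10 : yBasis.1 1 0 = ((√2 : ℝ) : ℂ)⁻¹ * (-Complex.I) := by simp [yBasis]
  have y11 : yBasis.1 1 1 = ((√2 : ℝ) : ℂ)⁻¹ * Complex.I := by simp [yBasis]
  rw [y00, y01, y10, y11]
  module

/-- The last qubit of a state is prepared from a state of the other qubits. -/
theorem exists_maps_append (Φ : Amplitudes (Q ⊕ Unit)) :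
    ∃ D, D * (Fintype.card Q + 1) ≤ 56 * 2 ^ Fintype.card Q + 2 * (Fintype.card Q + 1) ∧
      ∃ ρ : Amplitudes Q, (∀ x, ‖ρ x‖ ^ 2 = ∑ b, ‖Φ (app x b)‖ ^ 2) ∧
        Maps D (fun x : Q → Fin 2 => ρ x • ket (app x 0))
          (fun x => ∑ b, Φ (app x b) • ket (app x b)) := by
  -- The argument of `z x` is the rotation angle that splits the weight, and its modulus is what
  -- remains for `ρ`.
  set z : (Q → Fin 2) → ℂ := fun x => ⟨‖Φ (app x 0)‖, ‖Φ (app x 1)‖⟩ with hz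
  obtain ⟨D₁, hD₁, h₁⟩ := exists_maps_rotation fun x => (z x).arg
  -- Half the phase difference is odd in the new qubit, as a multiplexed rotation requires; the mean
  -- phase is absorbed into `ρ`.
  obtain ⟨D₂, hD₂, h₂⟩ := exists_mapsPhase_multiplexed (Sum.inr () : Q ⊕ Unit)
    (fun x => sgn (x (Sum.inr ())) * (((Φ (app (fun q => x (Sum.inl q)) 0)).arg -
      (Φ (app (fun q => x (Sum.inl q)) 1)).arg) / 2)) (by
      intro x
      simp [sgn_add, sgn_one])
  rw [Fintype.card_sum, Fintype.card_unit, pow_succ] at hD₂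
  refine ⟨D₁ + D₂, by nlinarith, fun x => (‖z x‖ : ℂ) *
    phase (((Φ (app x 0)).arg + (Φ (app x 1)).arg) / 2), fun x => ?_, ?_⟩
  · rw [norm_mul, norm_phase, mul_one, Complex.norm_real, norm_norm, ← Complex.normSq_eq_norm_sq]
    simp [hz, Complex.normSq_apply, Fin.sum_univ_two, sq]
  · have h₃ := Maps.sum (fun _ : Q → Fin 2 => (Finset.univ : Finset (Fin 2)))
      (fun x b => app x b) (fun x b => ((‖z x‖ : ℂ) *
        phase (((Φ (app x 0)).arg + (Φ (app x 1)).arg) / 2)) *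
        (if b = 0 then (Real.cos (z x).arg : ℂ) else (Real.sin (z x).arg : ℂ))) h₂
    refine (((h₁.smul _).congr (fun _ => rfl) fun x => ?_).trans h₃).congr (fun _ => rfl)
      fun x => ?_
    · simp only [Fin.sum_univ_two, smul_add, smul_smul]
      simp
    · have a0 : app x 0 (Sum.inr ()) = 0 := rfl
      have a1 : app x 1 (Sum.inr ()) = 1 := rfl
      have a2 : ∀ b, (fun q => app x b (Sum.inl q)) = x := fun b => rfl
      have hc : (‖z x‖ : ℂ) * (Real.cos (z x).arg : ℂ) = ‖Φ (app x 0)‖ := by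
        rw [← Complex.ofReal_mul, Complex.norm_mul_cos_arg]
      have hs : (‖z x‖ : ℂ) * (Real.sin (z x).arg : ℂ) = ‖Φ (app x 1)‖ := by
        rw [← Complex.ofReal_mul, Complex.norm_mul_sin_arg]
      have p0 : Φ (app x 0) = ‖Φ (app x 0)‖ * phase (Φ (app x 0)).arg :=
        (Complex.norm_mul_exp_arg_mul_I _).symm
      have p1 : Φ (app x 1) = ‖Φ (app x 1)‖ * phase (Φ (app x 1)).arg :=
        (Complex.norm_mul_exp_arg_mul_I _).symm
      simp only [Fin.sum_univ_two, a0, a1, a2, sgn_zero, sgn_one, one_mul, neg_one_mul,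
        smul_smul, if_true, Fin.isValue, one_ne_zero, if_false]
      congr 2
      · rw [mul_right_comm _ _ (Real.cos _ : ℂ), hc, mul_assoc, ← phase_add]
        conv_rhs => rw [p0]
        congr 2
        ring
      · rw [mul_right_comm _ _ (Real.sin _ : ℂ), hs, mul_assoc, ← phase_add]
        conv_rhs => rw [p1]
        congr 2
        ring

end Append

/-! ### Preparing states without ancillary qubits -/

/-- The bit string that consists of the bit `f`. -/
def bit (f : Fin 2) : Unit → Fin 2 := fun _ => f

/-- The diagonal unitary matrix with entries of modulus one. -/
noncomputable def diagUnitary (z : Fin 2 → ℂ) (hz : ∀ b, ‖z b‖ ^ 2 = 1) :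
    Matrix.unitaryGroup (Fin 2) ℂ :=
  ⟨Matrix.diagonal z, by
    rw [Matrix.mem_unitaryGroup_iff, Matrix.star_eq_conjTranspose,
      Matrix.diagonal_conjTranspose, Matrix.diagonal_mul_diagonal, ← Matrix.diagonal_one]
    congr 1
    funext b
    have := Complex.mul_conj (z b)
    rw [Complex.normSq_eq_norm_sq, hz] at this
    simpa using this⟩

/-- The equivalence that puts the appended qubit at position zero. -/
noncomputable def appendEquiv (ℓ : ℕ) : (Unit ⊕ Fin ℓ) ⊕ Unit ≃ Unit ⊕ Fin (ℓ + 1) :=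
  Equiv.ofBijective
    (fun q => match q with
      | Sum.inl (Sum.inl u) => Sum.inl u
      | Sum.inl (Sum.inr i) => Sum.inr i.succ
      | Sum.inr _ => Sum.inr 0)
    (by
      rw [Fintype.bijective_iff_injective_and_card]
      constructor
      · rintro ((u | i) | u) ((v | j) | v) h
        all_goals simp_all [Fin.succ_ne_zero, (Fin.succ_ne_zero _).symm]
      · simp
        omega)

theorem app_comp_appendEquiv_symm {ℓ : ℕ} (f b : Fin 2) (y : Fin ℓ → Fin 2) :
    app (Sum.elim (bit f) y) b ∘ (appendEquiv ℓ).symm =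
      Sum.elim (bit f) (Fin.cons b y : Fin (ℓ + 1) → Fin 2) := by
  rw [Equiv.comp_symm_eq]
  funext q
  rcases q with (u | i) | u <;> rfl

/-- Multiplexed state preparation without ancillary qubits, with a single control qubit. -/
theorem exists_maps_prepare (ℓ : ℕ) (Φ : Fin 2 → Amplitudes (Fin ℓ)) (hΦ : ∀ f, IsState (Φ f)) :
    ∃ D, D * (ℓ + 1) ≤ 232 * 2 ^ ℓ ∧
      Maps D (fun f => ket (Sum.elim (bit f) 0))
        (fun f => ∑ y, Φ f y • ket (Sum.elim (bit f) y)) := by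
  -- The extra bound at `ℓ = 0` serves the induction: the ratio (ℓ+2)/(ℓ+1) is 2 there and would
  -- leave no room for the new term, while for `ℓ ≥ 1` it is at most 3/2.
  suffices H : ∀ Φ : Amplitudes (Unit ⊕ Fin ℓ),
      (∀ f, ∑ y, ‖Φ (Sum.elim (bit f) y)‖ ^ 2 = 1) →
      ∃ D, D * (ℓ + 1) ≤ 232 * 2 ^ ℓ ∧ (ℓ = 0 → D ≤ 1) ∧
      Maps D (fun f => ket (Sum.elim (bit f) 0))
        (fun f => ∑ y, Φ (Sum.elim (bit f) y) • ket (Sum.elim (bit f) y)) by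
    obtain ⟨D, hD, -, h⟩ := H (fun x => Φ (x (Sum.inl ())) (fun i => x (Sum.inr i))) hΦ
    exact ⟨D, hD, h⟩
  clear hΦ Φ
  intro Φ hΦ
  induction ℓ with
  | zero =>
    have hz : ∀ f, ‖Φ (Sum.elim (bit f) 0)‖ ^ 2 = 1 := fun f => by
      rw [← hΦ f, Fintype.sum_subsingleton _ (0 : Fin 0 → Fin 2)]
    -- With no qubits left only a phase depending on `f` remains, and a diagonal gate on the control
    -- qubit supplies it.
    refine ⟨1, by norm_num, fun _ => le_rfl, ((maps_single (Sum.inl ()) (diagUnitary _ hz)).comp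
      fun f => ket (Sum.elim (bit f) 0)).congr (fun _ => rfl) fun f => ?_⟩
    rw [single_apply_ket, Fintype.sum_subsingleton _ (0 : Fin 0 → Fin 2), Finset.sum_eq_single f]
    · have h : Function.update (Sum.elim (bit f) 0) (Sum.inl ()) f =
          (Sum.elim (bit f) 0 : Unit ⊕ Fin 0 → Fin 2) := by
        funext q
        rcases q with u | i
        · rfl
        · exact i.elim0
      rw [h]
      congr 1
      simp [diagUnitary, bit]
    · intro b _ hb
      change Matrix.diagonal _ b f • _ = 0
      rw [Matrix.diagonal_apply_ne _ hb, zero_smul]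
    · exact fun h => absurd (Finset.mem_univ f) h
  | succ ℓ ih =>
    obtain ⟨D₁, hD₁, ρ, hρ, h₁⟩ := exists_maps_append (fun x => Φ (x ∘ (appendEquiv ℓ).symm))
    obtain ⟨D, hD, hD0, h⟩ := ih ρ (fun f => by
      rw [← hΦ f, ← (Fin.consEquiv fun _ => Fin 2).sum_comp, Fintype.sum_prod_type_right]
      refine Finset.sum_congr rfl fun y _ => ?_
      rw [hρ]
      refine Finset.sum_congr rfl fun b _ => ?_
      rw [app_comp_appendEquiv_symm]
      rfl)
    have h₂ : Maps D (fun f => ket (app (Sum.elim (bit f) (0 : Fin ℓ → Fin 2)) 0))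
        (fun f => ∑ y, ρ (Sum.elim (bit f) y) • ket (app (Sum.elim (bit f) y) 0)) := by
      refine ((h.par ((Maps.refl fun _ : Unit => ket (bit 0)).mono (Nat.zero_le D))).comp
        fun f => (f, ())).congr (fun f => tensor_ket _ _) fun f => ?_
      rw [tensor_sum_left]
      refine Finset.sum_congr rfl fun y _ => ?_
      rw [tensor_smul_left, tensor_ket]
      rfl
    have h₃ := h₁.sum (fun _ : Fin 2 => (Finset.univ : Finset (Fin ℓ → Fin 2)))
      (fun f y => Sum.elim (bit f) y) (fun _ _ => 1)
    simp only [one_smul] at h₃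
    refine ⟨D + D₁, ?_, by simp, ((h₂.trans h₃).relabel (appendEquiv ℓ)).congr (fun f => ?_)
      fun f => ?_⟩
    · rw [Fintype.card_sum, Fintype.card_unit, Fintype.card_fin, add_comm 1 ℓ, pow_succ] at hD₁
      rw [pow_succ]
      have hℓ : ℓ < 2 ^ ℓ := Nat.lt_two_pow_self
      rcases Nat.eq_zero_or_pos ℓ with rfl | hpos
      · have := hD0 rfl
        simp only [pow_zero] at *
        omega
      · nlinarith
    · rw [relabel_ket, app_comp_appendEquiv_symm]
      congr 2
      funext i
      refine Fin.cases ?_ (fun i => ?_) i <;> simp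
    · rw [relabel_sum, ← (Fin.consEquiv fun _ => Fin 2).sum_comp, Fintype.sum_prod_type_right]
      refine Finset.sum_congr rfl fun y _ => ?_
      rw [relabel_sum]
      refine Finset.sum_congr rfl fun b _ => ?_
      rw [relabel_smul, relabel_ket, app_comp_appendEquiv_symm]
      rfl

/-! ### Elementary classical gates on families of basis states -/

section Classical

variable {Q : Type} [Fintype Q] [DecidableEq Q] {κ : Type*} {x y : κ → Q → Fin 2}

theorem maps_cnots_of {ι : Type*} [Fintype ι] [DecidableEq ι] (c t : ι → Q)
    (hc : Function.Injective c) (ht : Function.Injective t) (hct : ∀ i j, c i ≠ t j)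
    (h1 : ∀ k i, y k (t i) = x k (t i) + x k (c i))
    (h2 : ∀ k q, (∀ i, t i ≠ q) → y k q = x k q) :
    Maps 1 (fun k => ket (x k)) (fun k => ket (y k)) := by
  refine ((maps_cnots c t hc ht hct).comp x).congr (fun _ => rfl) fun k => ?_
  congr 1
  funext q
  by_cases hq : ∃ i, t i = q
  · obtain ⟨i, rfl⟩ := hq
    rw [xorAt_target ht, h1]
  · push Not at hq
    rw [xorAt_of_forall_ne _ hq, h2 k q hq]

theorem maps_cnot_of (c t : Q) (hct : c ≠ t) (h1 : ∀ k, y k t = x k t + x k c)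
    (h2 : ∀ k q, q ≠ t → y k q = x k q) :
    Maps 1 (fun k => ket (x k)) (fun k => ket (y k)) :=
  maps_cnots_of (fun _ : Unit => c) (fun _ => t) (Function.injective_of_subsingleton _)
    (Function.injective_of_subsingleton _) (fun _ _ => hct) (fun k _ => h1 k)
    fun k q hq => h2 k q (hq ()).symm

/-- The logical conjunction of two bits, written to a qubit in the state `|0⟩`. -/
theorem maps_and :
    Maps 39 (fun x : Fin 2 → Fin 2 => ket (app x 0)) (fun x => ket (app x (x 0 * x 1))) := by
  -- Rotating by π/2 takes `|0⟩` to `|1⟩` with no stray phase. The bound 3D ≤ 28·4 + 6 gives 39.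
  obtain ⟨D, hD, h⟩ := exists_maps_rotation fun x : Fin 2 → Fin 2 =>
    if x 0 * x 1 = 1 then Real.pi / 2 else 0
  simp only [Fintype.card_fin] at hD
  refine (h.mono (by omega)).congr (fun _ => rfl) fun x => ?_
  have : x 0 * x 1 = 0 ∨ x 0 * x 1 = 1 := by
    generalize x 0 * x 1 = b
    revert b
    decide
  rcases this with h | h <;> simp [h]

theorem maps_and_of (a b c : Q) (hab : a ≠ b) (hac : a ≠ c) (hbc : b ≠ c)
    (h0 : ∀ k, x k c = 0) (h1 : ∀ k, y k c = x k a * x k b)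
    (h2 : ∀ k q, q ≠ c → y k q = x k q) :
    Maps 39 (fun k => ket (x k)) (fun k => ket (y k)) := by
  let f : Fin 2 ⊕ Unit ↪ Q := ⟨Sum.elim ![a, b] fun _ => c, by
    rintro (i | i) (j | j) h
    · fin_cases i <;> fin_cases j <;> simp_all
    · fin_cases i <;> simp_all
    · fin_cases j <;> simp_all
    · rfl⟩
  refine maps_and.extend_ket f x y (fun k => ![x k a, x k b]) (fun k q => ?_) (fun k q => ?_)
    fun k p hp => ?_
  · rcases q with i | u
    · fin_cases i <;> rfl
    · exact h0 k
  · rcases q with i | u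
    · fin_cases i
      · exact h2 k a hac
      · exact h2 k b hbc
    · exact h1 k
  · exact h2 k p fun e => hp ⟨Sum.inr (), e.symm⟩

/-- The Pauli matrix `X`. -/
def pauliX : Matrix.unitaryGroup (Fin 2) ℂ :=
  ⟨!![0, 1; 1, 0], by
    rw [Matrix.mem_unitaryGroup_iff]
    ext i j
    fin_cases i <;> fin_cases j <;> simp [Matrix.mul_apply, Fin.sum_univ_two, Matrix.star_apply]⟩

theorem maps_not_of (t : Q) (h1 : ∀ k, y k t = x k t + 1) (h2 : ∀ k q, q ≠ t → y k q = x k q) :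
    Maps 1 (fun k => ket (x k)) (fun k => ket (y k)) := by
  refine ((maps_single t pauliX).comp fun k => ket (x k)).congr (fun _ => rfl) fun k => ?_
  have hy : y k = Function.update (x k) t (x k t + 1) := by
    funext q
    by_cases hq : q = t
    · subst hq
      rw [Function.update_self, h1]
    · rw [Function.update_of_ne hq, h2 k q hq]
  rw [single_apply_ket, hy, Fin.sum_univ_two]
  generalize x k t = b
  fin_cases b <;> simp [pauliX]

end Classical

/-! ### Trees of registers -/

/-- A flag qubit, an auxiliary register of `h` qubits, and further qubits `X`. -/
abbrev Cell (h : ℕ) (X : Type) : Type := Unit ⊕ (Fin h ⊕ X)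

instance (h : ℕ) (X : Type) [DecidableEq X] : DecidableEq (Cell h X) := instDecidableEqSum

/-- The bit string on a cell with the given parts. -/
def cfg {h : ℕ} {X : Type} (f : Fin 2) (u : Fin h → Fin 2) (s : X → Fin 2) :
    Cell h X → Fin 2 := Sum.elim (bit f) (Sum.elim u s)

theorem cfg_zero {h : ℕ} {X : Type} : (cfg 0 0 0 : Cell h X → Fin 2) = 0 := by
  funext q
  rcases q with u | i | s <;> rfl

/-- The parts of a bit string on a cell with two child cells. -/
structure NodeBits (h : ℕ) (X : Type) where
  /-- The flag. -/
  f : Fin 2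
  /-- The auxiliary register. -/
  u : Fin (h + 1) → Fin 2
  /-- The flag of the left child. -/
  fl : Fin 2
  /-- The auxiliary register of the left child. -/
  ul : Fin h → Fin 2
  /-- The other qubits of the left child. -/
  sl : X → Fin 2
  /-- The flag of the right child. -/
  fr : Fin 2
  /-- The auxiliary register of the right child. -/
  ur : Fin h → Fin 2
  /-- The other qubits of the right child. -/
  sr : X → Fin 2

namespace NodeBits

variable {h : ℕ} {X : Type} [Fintype X] [DecidableEq X]

/-- The bit string with the given parts. -/
def conf (n : NodeBits h X) : Cell (h + 1) (Cell h X ⊕ Cell h X) → Fin 2 :=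
  cfg n.f n.u (Sum.elim (cfg n.fl n.ul n.sl) (cfg n.fr n.ur n.sr))

theorem maps_aux_to_left :
    Maps 1 (fun n : NodeBits h X => ket n.conf)
      (fun n => ket ({n with ul := fun i => n.ul i + n.u i.succ} : NodeBits h X).conf) := by
  refine maps_cnots_of (fun i : Fin h => Sum.inr (Sum.inl i.succ))
    (fun i => Sum.inr (Sum.inr (Sum.inl (Sum.inr (Sum.inl i))))) ?_ ?_ ?_ ?_ ?_
  · intro i j h
    simpa using h
  · intro i j h
    simpa using h
  · simp
  · intro n i
    rfl
  · rintro n (a | a | (a | a | a) | (a | a | a)) h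
    all_goals first | rfl | exact absurd rfl (h _)

theorem maps_aux_to_right :
    Maps 1 (fun n : NodeBits h X => ket n.conf)
      (fun n => ket ({n with ur := fun i => n.ur i + n.u i.succ} : NodeBits h X).conf) := by
  refine maps_cnots_of (fun i : Fin h => Sum.inr (Sum.inl i.succ))
    (fun i => Sum.inr (Sum.inr (Sum.inr (Sum.inr (Sum.inl i))))) ?_ ?_ ?_ ?_ ?_
  · intro i j h
    simpa using h
  · intro i j h
    simpa using h
  · simp
  · intro n i
    rfl
  · rintro n (a | a | (a | a | a) | (a | a | a)) h
    all_goals first | rfl | exact absurd rfl (h _)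

theorem maps_left_to_aux :
    Maps 1 (fun n : NodeBits h X => ket n.conf)
      (fun n => ket ({n with u := fun i => n.u i + Fin.cases 0 n.ul i} : NodeBits h X).conf) := by
  refine maps_cnots_of (fun i : Fin h => Sum.inr (Sum.inr (Sum.inl (Sum.inr (Sum.inl i)))))
    (fun i => Sum.inr (Sum.inl i.succ)) ?_ ?_ ?_ ?_ ?_
  · intro i j h
    simpa using h
  · intro i j h
    simpa using h
  · simp
  · intro n i
    rfl
  · rintro n (a | a | (a | a | a) | (a | a | a)) h
    case inr.inl =>
      induction a using Fin.cases with
      | zero => exact add_zero _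
      | succ i => exact absurd rfl (h i)
    all_goals rfl

theorem maps_right_to_aux :
    Maps 1 (fun n : NodeBits h X => ket n.conf)
      (fun n => ket ({n with u := fun i => n.u i + Fin.cases 0 n.ur i} : NodeBits h X).conf) := by
  refine maps_cnots_of (fun i : Fin h => Sum.inr (Sum.inr (Sum.inr (Sum.inr (Sum.inl i)))))
    (fun i => Sum.inr (Sum.inl i.succ)) ?_ ?_ ?_ ?_ ?_
  · intro i j h
    simpa using h
  · intro i j h
    simpa using h
  · simp
  · intro n i
    rfl
  · rintro n (a | a | (a | a | a) | (a | a | a)) h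
    case inr.inl =>
      induction a using Fin.cases with
      | zero => exact add_zero _
      | succ i => exact absurd rfl (h i)
    all_goals rfl

theorem maps_rightFlag_to_aux :
    Maps 1 (fun n : NodeBits h X => ket n.conf)
      (fun n => ket ({n with u := fun i => n.u i + Fin.cases n.fr 0 i} : NodeBits h X).conf) := by
  refine maps_cnot_of (Sum.inr (Sum.inr (Sum.inr (Sum.inl ())))) (Sum.inr (Sum.inl 0))
    (by simp) (fun n => rfl) ?_
  rintro n (a | a | (a | a | a) | (a | a | a)) h
  case inr.inl =>
    induction a using Fin.cases with
    | zero => exact absurd rfl h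
    | succ i => exact add_zero _
  all_goals rfl

theorem maps_flag_to_leftFlag :
    Maps 1 (fun n : NodeBits h X => ket n.conf)
      (fun n => ket ({n with fl := n.fl + n.f} : NodeBits h X).conf) := by
  refine maps_cnot_of (Sum.inl ()) (Sum.inr (Sum.inr (Sum.inl (Sum.inl ())))) (by simp)
    (fun n => rfl) ?_
  rintro n (a | a | (a | a | a) | (a | a | a)) h
  all_goals first | rfl | exact absurd rfl h

theorem maps_rightFlag_to_leftFlag :
    Maps 1 (fun n : NodeBits h X => ket n.conf)
      (fun n => ket ({n with fl := n.fl + n.fr} : NodeBits h X).conf) := by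
  refine maps_cnot_of (Sum.inr (Sum.inr (Sum.inr (Sum.inl ()))))
    (Sum.inr (Sum.inr (Sum.inl (Sum.inl ())))) (by simp) (fun n => rfl) ?_
  rintro n (a | a | (a | a | a) | (a | a | a)) h
  all_goals first | rfl | exact absurd rfl h

theorem maps_children {κ : Type*} {d : ℕ} {s t : κ → Amplitudes (Cell h X)} (hst : Maps d s t) :
    Maps d
      (fun p : (Fin 2 × (Fin (h + 1) → Fin 2)) × κ × κ =>
        tensor (ket (bit p.1.1)) (tensor (ket p.1.2) (tensor (s p.2.1) (s p.2.2))))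
      (fun p => tensor (ket (bit p.1.1)) (tensor (ket p.1.2) (tensor (t p.2.1) (t p.2.2)))) :=
  (((Maps.refl fun f : Fin 2 => ket (bit f)).mono (Nat.zero_le d)).par
    (((Maps.refl fun u : Fin (h + 1) → Fin 2 => ket u).mono (Nat.zero_le d)).par
      (hst.par hst))).comp fun p : (Fin 2 × (Fin (h + 1) → Fin 2)) × κ × κ =>
        (p.1.1, p.1.2, p.2)

end NodeBits

/-! ### The binary tree of registers -/

/-- The qubits of a tree of height `k` without the flag and the auxiliary register of its root; the
leaves hold `ℓ` qubits each. -/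
def Sub (ℓ : ℕ) : ℕ → Type
  | 0 => Fin ℓ
  | k + 1 => Cell (ℓ + k) (Sub ℓ k) ⊕ Cell (ℓ + k) (Sub ℓ k)

instance Sub.decidableEq (ℓ : ℕ) : ∀ k, DecidableEq (Sub ℓ k)
  | 0 => inferInstanceAs (DecidableEq (Fin ℓ))
  | k + 1 =>
    have := Sub.decidableEq ℓ k
    inferInstanceAs (DecidableEq (Cell (ℓ + k) (Sub ℓ k) ⊕ Cell (ℓ + k) (Sub ℓ k)))

instance Sub.fintype (ℓ : ℕ) : ∀ k, Fintype (Sub ℓ k)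
  | 0 => inferInstanceAs (Fintype (Fin ℓ))
  | k + 1 =>
    have := Sub.fintype ℓ k
    inferInstanceAs (Fintype (Cell (ℓ + k) (Sub ℓ k) ⊕ Cell (ℓ + k) (Sub ℓ k)))

theorem card_cell (h : ℕ) (X : Type) [Fintype X] :
    Fintype.card (Cell h X) = 1 + (h + Fintype.card X) := by
  simp [Cell]

/-- Registers grow only linearly with the height while the number of nodes halves, so the total is
governed by the 2^k leaves. -/
theorem card_cell_sub (ℓ k : ℕ) :
    Fintype.card (Cell (ℓ + k) (Sub ℓ k)) + (ℓ + k + 3) = (3 * ℓ + 4) * 2 ^ k := by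
  induction k with
  | zero =>
    have : Fintype.card (Sub ℓ 0) = ℓ := Fintype.card_fin ℓ
    rw [card_cell, this]
    omega
  | succ k ih =>
    have : Fintype.card (Sub ℓ (k + 1)) = Fintype.card (Cell (ℓ + k) (Sub ℓ k)) +
      Fintype.card (Cell (ℓ + k) (Sub ℓ k)) := Fintype.card_sum
    rw [card_cell, this, pow_succ, ← mul_assoc, ← ih]
    ring

/-- All bits of `w` multiplied by `g`. -/
def gated {h : ℕ} (g : Fin 2) (w : Fin h → Fin 2) : Fin h → Fin 2 := fun i => g * w i

theorem gated_zero {h : ℕ} (w : Fin h → Fin 2) : gated 0 w = 0 := by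
  funext i
  exact zero_mul _

theorem gated_one {h : ℕ} (w : Fin h → Fin 2) : gated 1 w = w := by
  funext i
  exact one_mul _

/-- The contents of the tree below a root with flag `f` that address the word `w`: the flags mark
the path to the addressed leaf, and that leaf holds the last `ℓ` bits of `w`. If `g = 1`, each
auxiliary register on the path holds the remaining bits of `w`; otherwise they are zero. -/
def content (ℓ : ℕ) (g : Fin 2) : (k : ℕ) → Fin 2 → (Fin (ℓ + k) → Fin 2) → Sub ℓ k → Fin 2
  | 0, f, w => gated f w
  | k + 1, f, w =>
    Sum.elim
      (cfg (f * (w 0 + 1)) (gated (g * (f * (w 0 + 1))) (Fin.tail w))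
        (content ℓ g k (f * (w 0 + 1)) (Fin.tail w)))
      (cfg (f * w 0) (gated (g * (f * w 0)) (Fin.tail w)) (content ℓ g k (f * w 0) (Fin.tail w)))

/-- Subtrees off the path are blank, so the two children of a node never both carry data. -/
theorem content_flag_zero (ℓ : ℕ) (g : Fin 2) (k : ℕ) (w : Fin (ℓ + k) → Fin 2) :
    content ℓ g k 0 w = 0 := by
  induction k with
  | zero => exact gated_zero w
  | succ k ih =>
    have h0 : ∀ b : Fin 2, 0 * b = 0 := by decide
    have h1 : ∀ b : Fin 2, b * 0 = 0 := by decide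
    simp only [content, h0, h1, ih, gated_zero, cfg_zero]
    funext q
    rcases q with q | q <;> rfl

/-- The bit string on a whole tree. -/
def tree (ℓ : ℕ) (g : Fin 2) (k : ℕ) (f : Fin 2) (w : Fin (ℓ + k) → Fin 2) :
    Cell (ℓ + k) (Sub ℓ k) → Fin 2 := cfg f (gated (g * f) w) (content ℓ g k f w)

theorem NodeBits.conf_eq_zero {h : ℕ} {X : Type} (f : Fin 2) (u : Fin (h + 1) → Fin 2) :
    (NodeBits.mk f u 0 0 0 0 0 0 : NodeBits h X).conf = cfg f u 0 := by
  funext q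
  rcases q with q | q | (q | q | q) | (q | q | q) <;> rfl

/-- Applying a classical transformation to both children of a node. -/
theorem NodeBits.maps_children_ket {h : ℕ} {X : Type} [Fintype X] [DecidableEq X] {κ ι : Type*}
    {d : ℕ} {x y : κ → Fin 2 × (Fin h → Fin 2) × (X → Fin 2)}
    (hxy : Maps d (fun k => ket (cfg (x k).1 (x k).2.1 (x k).2.2))
      (fun k => ket (cfg (y k).1 (y k).2.1 (y k).2.2)))
    (f : ι → Fin 2) (u : ι → Fin (h + 1) → Fin 2) (a b : ι → κ) :
    Maps d
      (fun i => ket (NodeBits.mk (f i) (u i) (x (a i)).1 (x (a i)).2.1 (x (a i)).2.2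
        (x (b i)).1 (x (b i)).2.1 (x (b i)).2.2).conf)
      (fun i => ket (NodeBits.mk (f i) (u i) (y (a i)).1 (y (a i)).2.1 (y (a i)).2.2
        (y (b i)).1 (y (b i)).2.1 (y (b i)).2.2).conf) := by
  refine ((maps_children hxy).comp fun i => ((f i, u i), a i, b i)).congr (fun i => ?_)
    fun i => ?_
  · simp only [tensor_ket]
    rfl
  · simp only [tensor_ket]
    rfl

/-! ### Routing a word to its leaf -/

theorem maps_and_leaf (ℓ : ℕ) :
    Maps (39 * ℓ)
      (fun p : Fin 2 × (Fin ℓ → Fin 2) => ket (cfg p.1 p.2 (0 : Fin ℓ → Fin 2)))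
      (fun p => ket (cfg p.1 p.2 (gated p.1 p.2))) := by
  have key : ∀ j, j ≤ ℓ → Maps (39 * j)
      (fun p : Fin 2 × (Fin ℓ → Fin 2) => ket (cfg p.1 p.2 (0 : Fin ℓ → Fin 2)))
      (fun p => ket (cfg p.1 p.2 fun i => if i.val < j then p.1 * p.2 i else 0)) := by
    intro j
    induction j with
    | zero => exact fun _ => (Maps.refl _).congr (fun _ => rfl) fun _ => by simp; rfl
    | succ j ih =>
      intro hj
      refine (ih (by omega)).trans ?_
      refine maps_and_of (Sum.inl ()) (Sum.inr (Sum.inl ⟨j, hj⟩)) (Sum.inr (Sum.inr ⟨j, hj⟩))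
        (by simp) (by simp) (by simp) ?_ ?_ ?_
      · intro p
        simp [cfg]
      · intro p
        simp [cfg, bit]
      · rintro p (q | q | q) hq
        · rfl
        · rfl
        · have : q.val ≠ j := fun h => hq (by subst h; rfl)
          simp only [cfg, Sum.elim_inr]
          congr 1
          rw [eq_iff_iff]
          omega
  refine (key ℓ le_rfl).congr (fun _ => rfl) fun p => ?_
  congr 2
  funext i
  rw [if_pos i.2]
  rfl

theorem mul_add_mul_bits : ∀ f b : Fin 2, f * b + f = f * (b + 1) := by decide

/-- Both children receive a copy of the remaining bits, the flags alone select the path, and the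
copies are erased after the recursion. The two subtrees work in parallel, so a level costs four
register copies, one conjunction of depth 39 and two CNOTs: 45. -/
theorem maps_route (ℓ k : ℕ) :
    Maps (39 * ℓ + 45 * k)
      (fun p : Fin 2 × (Fin (ℓ + k) → Fin 2) => ket (cfg p.1 p.2 (0 : Sub ℓ k → Fin 2)))
      (fun p => ket (cfg p.1 p.2 (content ℓ 0 k p.1 p.2))) := by
  induction k with
  | zero => exact maps_and_leaf ℓ
  | succ k ih =>
    have h1 := (NodeBits.maps_aux_to_left (h := ℓ + k) (X := Sub ℓ k)).comp
      fun p : Fin 2 × (Fin (ℓ + k + 1) → Fin 2) => ⟨p.1, p.2, 0, 0, 0, 0, 0, 0⟩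
    have h2 := (NodeBits.maps_aux_to_right (h := ℓ + k) (X := Sub ℓ k)).comp
      fun p : Fin 2 × (Fin (ℓ + k + 1) → Fin 2) =>
        ⟨p.1, p.2, 0, fun i => 0 + p.2 i.succ, 0, 0, 0, 0⟩
    have h3 : Maps 39
        (fun p : Fin 2 × (Fin (ℓ + k + 1) → Fin 2) => ket (⟨p.1, p.2, 0,
          fun i => 0 + p.2 i.succ, 0, 0, fun i => 0 + p.2 i.succ, 0⟩ :
          NodeBits (ℓ + k) (Sub ℓ k)).conf)
        (fun p => ket (⟨p.1, p.2, 0,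
          fun i => 0 + p.2 i.succ, 0, p.1 * p.2 0, fun i => 0 + p.2 i.succ, 0⟩ :
          NodeBits (ℓ + k) (Sub ℓ k)).conf) := by
      refine maps_and_of (Sum.inl ()) (Sum.inr (Sum.inl 0))
        (Sum.inr (Sum.inr (Sum.inr (Sum.inl ())))) (by simp) (by simp) (by simp)
        (fun _ => rfl) (fun _ => rfl) ?_
      rintro n (a | a | (a | a | a) | (a | a | a)) h
      all_goals first | rfl | exact absurd rfl h
    have h4 := (NodeBits.maps_flag_to_leftFlag (h := ℓ + k) (X := Sub ℓ k)).comp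
      fun p : Fin 2 × (Fin (ℓ + k + 1) → Fin 2) => ⟨p.1, p.2, 0 + p.1 * p.2 0,
          fun i => 0 + p.2 i.succ, 0, p.1 * p.2 0, fun i => 0 + p.2 i.succ, 0⟩
    have h5 := (NodeBits.maps_rightFlag_to_leftFlag (h := ℓ + k) (X := Sub ℓ k)).comp
      fun p : Fin 2 × (Fin (ℓ + k + 1) → Fin 2) => ⟨p.1, p.2, 0,
          fun i => 0 + p.2 i.succ, 0, p.1 * p.2 0, fun i => 0 + p.2 i.succ, 0⟩
    have h6 := NodeBits.maps_children_ket
      (x := fun p : Fin 2 × (Fin (ℓ + k) → Fin 2) => (p.1, p.2, 0))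
      (y := fun p => (p.1, p.2, content ℓ 0 k p.1 p.2)) ih
      (fun p : Fin 2 × (Fin (ℓ + k + 1) → Fin 2) => p.1) (fun p => p.2)
      (fun p => (0 + p.1 * p.2 0 + p.1, fun i => 0 + p.2 i.succ))
      (fun p => (p.1 * p.2 0, fun i => 0 + p.2 i.succ))
    have h7 := ((NodeBits.maps_aux_to_left (h := ℓ + k) (X := Sub ℓ k)).comp
      fun p : Fin 2 × (Fin (ℓ + k + 1) → Fin 2) => ⟨p.1, p.2, 0 + p.1 * p.2 0 + p.1, 0,
        content ℓ 0 k (0 + p.1 * p.2 0 + p.1) (fun i => 0 + p.2 i.succ), p.1 * p.2 0,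
        fun i => 0 + p.2 i.succ, content ℓ 0 k (p.1 * p.2 0) (fun i => 0 + p.2 i.succ)⟩).symm
    have h8 := ((NodeBits.maps_aux_to_right (h := ℓ + k) (X := Sub ℓ k)).comp
      fun p : Fin 2 × (Fin (ℓ + k + 1) → Fin 2) => ⟨p.1, p.2, 0 + p.1 * p.2 0 + p.1, 0,
        content ℓ 0 k (0 + p.1 * p.2 0 + p.1) (fun i => 0 + p.2 i.succ), p.1 * p.2 0, 0,
        content ℓ 0 k (p.1 * p.2 0) (fun i => 0 + p.2 i.succ)⟩).symm
    refine ((((((((h1.trans h2).trans h3).trans h5).trans h4).trans h6).trans h7).trans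
      h8).mono (by omega)).congr (fun p => ?_) fun p => ?_
    · congr 1
      exact NodeBits.conf_eq_zero _ _
    · congr 1
      simp only [NodeBits.conf, content, zero_add, mul_add_mul_bits, zero_mul, gated_zero]
      rfl

/-! ### Merging the leaves -/

/-- At most one child is on the path, so adding both child registers yields the tail of `w` without
a control; the first bit of `w` is the flag of the right child. -/
theorem maps_merge (ℓ k : ℕ) :
    Maps (3 * k + 1)
      (fun p : Fin 2 × (Fin (ℓ + k) → Fin 2) => ket (tree ℓ 0 k p.1 p.2))
      (fun p => ket (tree ℓ 1 k p.1 p.2)) := by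
  induction k with
  | zero =>
    refine maps_cnots_of (fun i : Fin ℓ => Sum.inr (Sum.inr i)) (fun i => Sum.inr (Sum.inl i))
      ?_ ?_ ?_ ?_ ?_
    · intro i j h
      exact Sum.inr_injective (Sum.inr_injective h)
    · intro i j h
      exact Sum.inl_injective (Sum.inr_injective h)
    · intro i j h
      exact Sum.inr_ne_inl (Sum.inr_injective h)
    · intro p i
      change 1 * p.1 * p.2 i = 0 * p.1 * p.2 i + p.1 * p.2 i
      simp
    · rintro p (q | q | q) hq
      · rfl
      · exact absurd rfl (hq q)
      · rfl
  | succ k ih =>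
    have h1 := NodeBits.maps_children_ket
      (x := fun p : Fin 2 × (Fin (ℓ + k) → Fin 2) =>
        (p.1, gated (0 * p.1) p.2, content ℓ 0 k p.1 p.2))
      (y := fun p => (p.1, gated (1 * p.1) p.2, content ℓ 1 k p.1 p.2)) ih
      (fun p : Fin 2 × (Fin (ℓ + k + 1) → Fin 2) => p.1) (fun p => gated (0 * p.1) p.2)
      (fun p => (p.1 * (p.2 0 + 1), Fin.tail p.2))
      (fun p => (p.1 * p.2 0, Fin.tail p.2))
    have h2 := (NodeBits.maps_left_to_aux (h := ℓ + k) (X := Sub ℓ k)).comp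
      fun p : Fin 2 × (Fin (ℓ + k + 1) → Fin 2) => ⟨p.1, gated (0 * p.1) p.2, p.1 * (p.2 0 + 1),
        gated (1 * (p.1 * (p.2 0 + 1))) (Fin.tail p.2),
        content ℓ 1 k (p.1 * (p.2 0 + 1)) (Fin.tail p.2), p.1 * p.2 0,
        gated (1 * (p.1 * p.2 0)) (Fin.tail p.2), content ℓ 1 k (p.1 * p.2 0) (Fin.tail p.2)⟩
    have h3 := (NodeBits.maps_right_to_aux (h := ℓ + k) (X := Sub ℓ k)).comp
      fun p : Fin 2 × (Fin (ℓ + k + 1) → Fin 2) => ⟨p.1, fun i => gated (0 * p.1) p.2 i +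
        Fin.cases 0 (gated (1 * (p.1 * (p.2 0 + 1))) (Fin.tail p.2)) i, p.1 * (p.2 0 + 1),
        gated (1 * (p.1 * (p.2 0 + 1))) (Fin.tail p.2),
        content ℓ 1 k (p.1 * (p.2 0 + 1)) (Fin.tail p.2), p.1 * p.2 0,
        gated (1 * (p.1 * p.2 0)) (Fin.tail p.2), content ℓ 1 k (p.1 * p.2 0) (Fin.tail p.2)⟩
    have h4 := (NodeBits.maps_rightFlag_to_aux (h := ℓ + k) (X := Sub ℓ k)).comp
      fun p : Fin 2 × (Fin (ℓ + k + 1) → Fin 2) => ⟨p.1, fun i => gated (0 * p.1) p.2 i +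
        Fin.cases 0 (gated (1 * (p.1 * (p.2 0 + 1))) (Fin.tail p.2)) i +
        Fin.cases 0 (gated (1 * (p.1 * p.2 0)) (Fin.tail p.2)) i, p.1 * (p.2 0 + 1),
        gated (1 * (p.1 * (p.2 0 + 1))) (Fin.tail p.2),
        content ℓ 1 k (p.1 * (p.2 0 + 1)) (Fin.tail p.2), p.1 * p.2 0,
        gated (1 * (p.1 * p.2 0)) (Fin.tail p.2), content ℓ 1 k (p.1 * p.2 0) (Fin.tail p.2)⟩
    refine ((((h1.trans h2).trans h3).trans h4).mono (by omega)).congr (fun p => rfl)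
      fun p => ?_
    congr 1
    simp only [NodeBits.conf, tree, content]
    congr 1
    funext i
    induction i using Fin.cases with
    | zero => simp [gated]
    | succ i =>
      have : ∀ f b c : Fin 2, 0 * f * c + 1 * (f * (b + 1)) * c + 1 * (f * b) * c + 0 =
        1 * f * c := by decide
      exact this p.1 (p.2 0) (p.2 i.succ)

/-! ### Preparing the superposition of paths -/

theorem sum_eq_sum_cons {h : ℕ} {M : Type*} [AddCommMonoid M] (F : (Fin (h + 1) → Fin 2) → M) :
    ∑ w, F w = ∑ w, F (Fin.cons 0 w) + ∑ w, F (Fin.cons 1 w) := by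
  rw [← (Fin.consEquiv fun _ => Fin 2).sum_comp, Fintype.sum_prod_type, Fin.sum_univ_two]
  rfl

/-- A state splits into two states with real weights according to its zeroth qubit. -/
theorem exists_split {h : ℕ} (ψ : Amplitudes (Fin (h + 1))) (hψ : IsState ψ) :
    ∃ (θ : ℝ) (ψ₀ ψ₁ : Amplitudes (Fin h)), IsState ψ₀ ∧ IsState ψ₁ ∧
      (∀ y, ψ (Fin.cons 0 y) = Real.cos θ * ψ₀ y) ∧ ∀ y, ψ (Fin.cons 1 y) = Real.sin θ * ψ₁ y := by
  have key : ∀ φ : Amplitudes (Fin h), ∃ χ : Amplitudes (Fin h), IsState χ ∧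
      ∀ y, φ y = √(∑ y, ‖φ y‖ ^ 2) * χ y := by
    intro φ
    by_cases h0 : ∑ y, ‖φ y‖ ^ 2 = 0
    -- A half of weight zero may be assigned any state.
    · refine ⟨ketZero _, ?_, fun y => ?_⟩
      · rw [IsState, Finset.sum_eq_single 0]
        · simp [ketZero]
        · intro y _ hy
          simp [ketZero, hy]
        · simp
      · rw [Finset.sum_eq_zero_iff_of_nonneg fun _ _ => by positivity] at h0
        have := h0 y (Finset.mem_univ y)
        rw [show φ y = 0 by simpa using this,
          Finset.sum_eq_zero fun z _ => h0 z (Finset.mem_univ z)]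
        simp
    · have hpos : 0 < ∑ y, ‖φ y‖ ^ 2 :=
        lt_of_le_of_ne (Finset.sum_nonneg fun _ _ => by positivity) (Ne.symm h0)
      have hs : ((√(∑ y, ‖φ y‖ ^ 2) : ℝ) : ℂ) ≠ 0 := by
        rw [Ne, Complex.ofReal_eq_zero]
        exact (Real.sqrt_pos.2 hpos).ne'
      refine ⟨fun y => (√(∑ y, ‖φ y‖ ^ 2) : ℂ)⁻¹ * φ y, ?_, fun y => ?_⟩
      · rw [IsState]
        have : ∀ y, ‖((√(∑ y, ‖φ y‖ ^ 2) : ℝ) : ℂ)⁻¹ * φ y‖ ^ 2 =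
            (∑ y, ‖φ y‖ ^ 2)⁻¹ * ‖φ y‖ ^ 2 := by
          intro y
          rw [norm_mul, norm_inv, Complex.norm_real, mul_pow, inv_pow, Real.norm_eq_abs, sq_abs,
            Real.sq_sqrt hpos.le]
        simp only [this]
        rw [← Finset.mul_sum, inv_mul_cancel₀ h0]
      · rw [mul_inv_cancel_left₀ hs]
  obtain ⟨ψ₀, h₀, e₀⟩ := key fun y => ψ (Fin.cons 0 y)
  obtain ⟨ψ₁, h₁, e₁⟩ := key fun y => ψ (Fin.cons 1 y)
  set a := √(∑ y, ‖ψ (Fin.cons 0 y)‖ ^ 2) with ha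
  set b := √(∑ y, ‖ψ (Fin.cons 1 y)‖ ^ 2) with hb
  have hab : a ^ 2 + b ^ 2 = 1 := by
    rw [ha, hb, Real.sq_sqrt (Finset.sum_nonneg fun _ _ => by positivity),
      Real.sq_sqrt (Finset.sum_nonneg fun _ _ => by positivity), ← hψ,
      sum_eq_sum_cons]
  have hn : ‖(⟨a, b⟩ : ℂ)‖ = 1 := by
    rw [← sq_eq_sq₀ (norm_nonneg _) zero_le_one, ← Complex.normSq_eq_norm_sq,
      Complex.normSq_apply]
    linarith
  have hc := Complex.norm_mul_cos_arg (⟨a, b⟩ : ℂ)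
  have hs := Complex.norm_mul_sin_arg (⟨a, b⟩ : ℂ)
  rw [hn, one_mul] at hc hs
  exact ⟨(⟨a, b⟩ : ℂ).arg, ψ₀, ψ₁, h₀, h₁, fun y => by rw [hc]; exact e₀ y,
    fun y => by rw [hs]; exact e₁ y⟩

/-- The superposition of paths in a tree below a root with flag `f`. -/
noncomputable def pathState (ℓ k : ℕ) (ψ : Amplitudes (Fin (ℓ + k))) (f : Fin 2) :
    Amplitudes (Cell (ℓ + k) (Sub ℓ k)) :=
  if f = 0 then ket (cfg 0 0 0) else ∑ w, ψ w • ket (tree ℓ 0 k 1 w)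

/-- The flag is the control of the multiplexed preparation: flag 0 selects the zero state, so leaves
off the path stay blank. -/
theorem exists_maps_leaf (ℓ : ℕ) (ψ : Amplitudes (Fin ℓ)) (hψ : IsState ψ) :
    ∃ D, D * (ℓ + 1) ≤ 232 * 2 ^ ℓ ∧
      Maps D (fun f => ket (cfg f 0 0 : Cell (ℓ + 0) (Sub ℓ 0) → Fin 2)) (pathState ℓ 0 ψ) := by
  have h0 : IsState (ketZero (Fin ℓ)) := by
    rw [IsState, Finset.sum_eq_single 0]
    · simp [ketZero]
    · intro y _ hy
      simp [ketZero, hy]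
    · simp
  obtain ⟨D, hD, h⟩ := exists_maps_prepare ℓ (fun f => if f = 0 then ketZero _ else ψ)
    (fun f => by
      split_ifs
      · exact h0
      · exact hψ)
  let g : Unit ⊕ Fin ℓ ↪ Cell (ℓ + 0) (Sub ℓ 0) :=
    ⟨Sum.elim Sum.inl fun i => Sum.inr (Sum.inr i), by
      rintro (q | q) (p | p) h
      · rfl
      · exact absurd h Sum.inl_ne_inr
      · exact absurd h Sum.inr_ne_inl
      · exact congrArg Sum.inr (Sum.inr_injective (Sum.inr_injective h))⟩
  have hext : ∀ f (y : Fin ℓ → Fin 2), extend g (ket (Sum.elim (bit f) y)) 0 =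
      ket (cfg f (0 : Fin (ℓ + 0) → Fin 2) (y : Sub ℓ 0 → Fin 2)) := by
    intro f y
    refine extend_ket g _ _ _ ?_ ?_
    · rintro (q | q) <;> rfl
    · rintro (q | q | q) hq
      · exact absurd ⟨Sum.inl q, rfl⟩ hq
      · rfl
      · exact absurd ⟨Sum.inr q, rfl⟩ hq
  refine ⟨D, hD, ((h.extend g).comp fun f => (f, 0)).congr (fun f => hext f 0) fun f => ?_⟩
  rw [extend_sum]
  simp only [extend_smul, hext]
  unfold pathState
  split_ifs with hf
  · subst hf
    rw [Finset.sum_eq_single 0]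
    · simp only [if_true, ketZero]
      exact one_smul _ _
    · intro y _ hy
      simp only [ketZero, if_neg hy]
      exact zero_smul _ _
    · exact fun h => absurd (Finset.mem_univ _) h
  · refine Finset.sum_congr rfl fun w _ => ?_
    have : f = 1 := by
      revert hf
      revert f
      decide
    subst this
    congr 2
    rw [tree, zero_mul, gated_zero]
    change _ = cfg 1 0 (gated 1 w)
    rw [gated_one]

theorem exists_maps_path (ℓ k : ℕ) (ψ : Amplitudes (Fin (ℓ + k))) (hψ : IsState ψ) :
    ∃ D, D * (ℓ + 1) ≤ 232 * 2 ^ ℓ ∧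
      Maps (D + 32 * k) (fun f => ket (cfg f 0 0)) (pathState ℓ k ψ) := by
  -- `D` must not depend on `ψ`: the two children prepare different states within the same depth.
  suffices H : ∃ D, D * (ℓ + 1) ≤ 232 * 2 ^ ℓ ∧ ∀ ψ : Amplitudes (Fin (ℓ + k)), IsState ψ →
      Maps (D + 32 * k) (fun f => ket (cfg f 0 0)) (pathState ℓ k ψ) by
    obtain ⟨D, hD, h⟩ := H
    exact ⟨D, hD, h ψ hψ⟩
  clear hψ ψ
  induction k with
  | zero =>
    refine ⟨232 * 2 ^ ℓ / (ℓ + 1), Nat.div_mul_le_self _ _, fun ψ hψ => ?_⟩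
    obtain ⟨D, hD, h⟩ := exists_maps_leaf ℓ ψ hψ
    exact h.mono (by rw [mul_zero, add_zero]; exact (Nat.le_div_iff_mul_le (by omega)).2 hD)
  | succ k ih =>
    obtain ⟨D, hD, ih⟩ := ih
    refine ⟨D, hD, fun ψ hψ => ?_⟩
    obtain ⟨θ, ψ₀, ψ₁, h₀, h₁, e₀, e₁⟩ := exists_split ψ hψ
    -- If the node is on the path, the right flag receives the amplitudes of the two halves; the
    -- left flag is then the sum of the two other flags. The bound 2D' ≤ 28·2 + 4 gives 30, and the
    -- two CNOTs make 32 per level.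
    have hrot : Maps 30 (fun x : Unit → Fin 2 => ket (app x 0))
        (fun x => ∑ b, (if x () = 0 then (if b = 0 then 1 else 0) else
          (if b = 0 then (Real.cos θ : ℂ) else (Real.sin θ : ℂ))) • ket (app x b)) := by
      obtain ⟨D', hD', h'⟩ := exists_maps_rotation fun x : Unit → Fin 2 =>
        if x () = 0 then 0 else θ
      rw [Fintype.card_unit] at hD'
      refine (h'.mono (by omega)).congr (fun _ => rfl) fun x => ?_
      rw [Fin.sum_univ_two]
      by_cases hx : x () = 0 <;> simp [hx]
    let g : Unit ⊕ Unit ↪ Cell (ℓ + k + 1) (Cell (ℓ + k) (Sub ℓ k) ⊕ Cell (ℓ + k) (Sub ℓ k)) :=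
      ⟨Sum.elim Sum.inl fun _ => Sum.inr (Sum.inr (Sum.inr (Sum.inl ()))), by
        rintro (q | q) (p | p) h
        · rfl
        · exact absurd h Sum.inl_ne_inr
        · exact absurd h Sum.inr_ne_inl
        · rfl⟩
    have hext : ∀ f b, extend g (ket (app (bit f) b)) 0 =
        ket (⟨f, 0, 0, 0, 0, b, 0, 0⟩ : NodeBits (ℓ + k) (Sub ℓ k)).conf := by
      intro f b
      refine extend_ket g _ _ _ ?_ ?_
      · rintro (q | q) <;> rfl
      · rintro (a | a | (a | a | a) | (a | a | a)) h
        all_goals first | rfl | exact absurd ⟨Sum.inl (), rfl⟩ h | exact absurd ⟨Sum.inr (), rfl⟩ h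
    set c : Fin 2 → Fin 2 → ℂ := fun f b => if f = 0 then (if b = 0 then 1 else 0) else
          (if b = 0 then (Real.cos θ : ℂ) else (Real.sin θ : ℂ)) with hc
    have s1 : Maps 30 (fun f => ket (⟨f, 0, 0, 0, 0, 0, 0, 0⟩ : NodeBits (ℓ + k) (Sub ℓ k)).conf)
        (fun f => ∑ b, c f b • ket
          (⟨f, 0, 0, 0, 0, b, 0, 0⟩ : NodeBits (ℓ + k) (Sub ℓ k)).conf) := by
      refine ((hrot.extend g).comp fun f => (bit f, 0)).congr (fun f => hext f 0) fun f => ?_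
      rw [extend_sum]
      refine Finset.sum_congr rfl fun b _ => ?_
      rw [extend_smul, hext]
      rfl
    have s2 := (NodeBits.maps_rightFlag_to_leftFlag (h := ℓ + k) (X := Sub ℓ k)).comp
      fun p : Fin 2 × Fin 2 => ⟨p.1, 0, 0, 0, 0, p.2, 0, 0⟩
    have s3 := (NodeBits.maps_flag_to_leftFlag (h := ℓ + k) (X := Sub ℓ k)).comp
      fun p : Fin 2 × Fin 2 => ⟨p.1, 0, 0 + p.2, 0, 0, p.2, 0, 0⟩
    have s4 : Maps (D + 32 * k)
        (fun p : Fin 2 × Fin 2 => ket (⟨p.1, 0, 0 + p.2 + p.1, 0, 0, p.2, 0, 0⟩ :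
          NodeBits (ℓ + k) (Sub ℓ k)).conf)
        (fun p => tensor (ket (bit p.1)) (tensor (ket (0 : Fin (ℓ + k + 1) → Fin 2))
          (tensor (pathState ℓ k ψ₀ (0 + p.2 + p.1)) (pathState ℓ k ψ₁ p.2)))) := by
      refine ((((Maps.refl fun f : Fin 2 => ket (bit f)).mono (Nat.zero_le (D + 32 * k))).par
        (((Maps.refl fun _ : Unit => ket (0 : Fin (ℓ + k + 1) → Fin 2)).mono
          (Nat.zero_le (D + 32 * k))).par ((ih ψ₀ h₀).par (ih ψ₁ h₁)))).comp
        fun p : Fin 2 × Fin 2 => (p.1, (), 0 + p.2 + p.1, p.2)).congr (fun p => ?_) fun p => rfl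
      simp only [tensor_ket]
      rfl
    have s5 := Maps.sum (fun _ : Fin 2 => (Finset.univ : Finset (Fin 2)))
      (fun f b => (f, b)) c ((s2.trans s3).trans s4)
    refine ((s1.trans s5).mono (by omega)).congr (fun f => ?_) fun f => ?_
    · congr 1
      exact NodeBits.conf_eq_zero _ _
    · have p0 : ∀ φ, pathState ℓ k φ 0 = ket (cfg 0 0 0) := fun φ => if_pos rfl
      have p1 : ∀ φ, pathState ℓ k φ 1 = ∑ w, φ w • ket (tree ℓ 0 k 1 w) :=
        fun φ => if_neg (by decide)
      have h11 : (1 + 1 : Fin 2) = 0 := by decide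
      have hR : pathState ℓ (k + 1) ψ 1 =
          ∑ w, ψ (Fin.cons 0 w) • ket (tree ℓ 0 (k + 1) 1 (Fin.cons 0 w)) +
          ∑ w, ψ (Fin.cons 1 w) • ket (tree ℓ 0 (k + 1) 1 (Fin.cons 1 w)) := by
        rw [pathState, if_neg (by decide)]
        exact sum_eq_sum_cons (h := ℓ + k) _
      rw [Fin.sum_univ_two]
      have hf : f = 0 ∨ f = 1 := by
        revert f
        decide
      rcases hf with rfl | rfl
      · simp only [hc, if_true, one_smul, add_zero, p0, tensor_ket, Fin.isValue, one_ne_zero,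
          if_false, zero_smul]
        rw [pathState, if_pos rfl]
        congr 1
        funext q
        rcases q with q | q | (q | q | q) | (q | q | q) <;> rfl
      · simp only [hc, if_true, zero_add, Fin.isValue, one_ne_zero, if_false, h11,
          add_zero, p0, p1]
        refine Eq.trans ?_ hR.symm
        simp only [tensor_sum_left, tensor_sum_right, tensor_smul_left, tensor_smul_right,
          tensor_ket, Finset.smul_sum, smul_smul]
        congr 1
        · refine Finset.sum_congr rfl fun w _ => ?_
          rw [← e₀]
          congr 2
          rw [tree]
          change _ = cfg 1 _ (Sum.elim (cfg (1 * (0 + 1)) (gated (0 * (1 * (0 + 1))) w)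
            (content ℓ 0 k (1 * (0 + 1)) w)) (cfg (1 * 0) (gated (0 * (1 * 0)) w)
            (content ℓ 0 k (1 * 0) w)))
          simp only [mul_one, mul_zero, zero_add, gated_zero, content_flag_zero]
          rfl
        · refine Finset.sum_congr rfl fun w _ => ?_
          rw [← e₁]
          congr 2
          rw [tree]
          change _ = cfg 1 _ (Sum.elim (cfg (1 * (1 + 1)) (gated (0 * (1 * (1 + 1))) w)
            (content ℓ 0 k (1 * (1 + 1)) w)) (cfg (1 * 1) (gated (0 * (1 * 1)) w)
            (content ℓ 0 k (1 * 1) w)))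
          simp only [h11, mul_one, mul_zero, gated_zero, content_flag_zero]
          rfl

/-! ### State preparation with a tree of ancillary qubits -/

theorem maps_inr {A B : Type} [Fintype A] [DecidableEq A] [Fintype B] [DecidableEq B]
    {ι κ : Type*} {d : ℕ} {x y : ι → B → Fin 2} (h : Maps d (fun i => ket (x i))
      (fun i => ket (y i))) (o : κ → A → Fin 2) (i : κ → ι) :
    Maps d (fun k => ket (Sum.elim (o k) (x (i k)))) (fun k => ket (Sum.elim (o k) (y (i k)))) := by
  refine ((((Maps.refl fun k : κ => ket (o k)).mono (Nat.zero_le d)).par h).comp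
    fun k => (k, i k)).congr (fun k => ?_) fun k => ?_ <;> simp only [tensor_ket]

/-- Preparing the tree entangles it with `w`, so it must be cleared coherently. Once `w` has been
merged and copied to the output, the merge is undone, `w` is written back to the root register,
inverse routing erases the flags and leaf, and a last copy clears the root register. -/
theorem exists_circuit_tree (ℓ k : ℕ) (ψ : Amplitudes (Fin (ℓ + k))) (hψ : IsState ψ) :
    ∃ D, D * (ℓ + 1) ≤ 232 * 2 ^ ℓ ∧
      ∃ C : Circuit (Fin (ℓ + k) ⊕ Cell (ℓ + k) (Sub ℓ k)),
        C.depth ≤ D + 83 * k + 39 * ℓ + 7 ∧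
        C.apply (tensor (ketZero _) (ketZero _)) = tensor ψ (ketZero _) := by
  obtain ⟨D, hD, hprep⟩ := exists_maps_path ℓ k ψ hψ
  have a0 : Maps 1 (fun _ : Unit => ket (Sum.elim (0 : Fin (ℓ + k) → Fin 2)
        (cfg 0 0 0 : Cell (ℓ + k) (Sub ℓ k) → Fin 2)))
      (fun _ => ket (Sum.elim 0 (cfg 1 0 0))) := by
    refine maps_not_of (Sum.inr (Sum.inl ())) (fun _ => rfl) ?_
    rintro u (q | q | q | q) hq
    all_goals first | rfl | exact absurd rfl hq
  have a1 : Maps (D + 32 * k) (fun _ : Unit => ket (Sum.elim (0 : Fin (ℓ + k) → Fin 2)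
        (cfg 1 0 0 : Cell (ℓ + k) (Sub ℓ k) → Fin 2)))
      (fun _ => ∑ w, ψ w • ket (Sum.elim 0 (tree ℓ 0 k 1 w))) := by
    refine ((((Maps.refl fun _ : Unit => ket (0 : Fin (ℓ + k) → Fin 2)).mono
      (Nat.zero_le (D + 32 * k))).par hprep).comp fun u => (u, 1)).congr (fun _ => ?_)
      fun _ => ?_
    · rw [tensor_ket]
    · rw [pathState, if_neg (show ¬ (1 : Fin 2) = 0 by decide)]
      simp only [tensor_sum_right, tensor_smul_right, tensor_ket]
  have b1 := maps_inr (maps_merge ℓ k) (fun _ : Fin (ℓ + k) → Fin 2 => (0 : Fin (ℓ + k) → Fin 2))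
    fun w => (1, w)
  have b2 : Maps 1 (fun w : Fin (ℓ + k) → Fin 2 => ket (Sum.elim (0 : Fin (ℓ + k) → Fin 2)
        (tree ℓ 1 k 1 w))) (fun w => ket (Sum.elim w (tree ℓ 1 k 1 w))) := by
    refine maps_cnots_of (fun i : Fin (ℓ + k) => Sum.inr (Sum.inr (Sum.inl i))) Sum.inl ?_
      Sum.inl_injective (by simp) ?_ ?_
    · intro i j h
      simpa using h
    · intro w i
      have : ∀ b : Fin 2, b = 0 + 1 * 1 * b := by decide
      exact this (w i)
    · rintro w (q | q) hq
      · exact absurd rfl (hq q)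
      · rfl
  have b3 := maps_inr (maps_merge ℓ k).symm (fun w : Fin (ℓ + k) → Fin 2 => w) fun w => (1, w)
  have hcopy : ∀ (u v : (Fin (ℓ + k) → Fin 2) → Fin (ℓ + k) → Fin 2)
      (s : (Fin (ℓ + k) → Fin 2) → Sub ℓ k → Fin 2), (∀ w i, v w i = u w i + w i) →
      Maps 1 (fun w : Fin (ℓ + k) → Fin 2 => ket (Sum.elim w (cfg 1 (u w) (s w))))
        (fun w => ket (Sum.elim w (cfg 1 (v w) (s w)))) := by
    intro u v s huv
    refine maps_cnots_of Sum.inl (fun i : Fin (ℓ + k) => Sum.inr (Sum.inr (Sum.inl i)))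
      Sum.inl_injective ?_ (by simp) huv ?_
    · intro i j h
      simpa using h
    · rintro w (q | q | q | q) hq
      all_goals first | rfl | exact absurd rfl (hq q)
  have b4 := hcopy (fun w => gated (0 * 1) w) (fun w => w) (fun w => content ℓ 0 k 1 w)
    (fun w i => by
      have : ∀ b : Fin 2, b = 0 * 1 * b + b := by decide
      exact this (w i))
  have b5 := maps_inr (maps_route ℓ k).symm (fun w : Fin (ℓ + k) → Fin 2 => w) fun w => (1, w)
  have b6 := hcopy (fun w => w) (fun _ => 0) (fun _ => 0)
    (fun w i => by
      have : ∀ b : Fin 2, 0 = b + b := by decide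
      exact this (w i))
  have b7 : Maps 1 (fun w : Fin (ℓ + k) → Fin 2 => ket (Sum.elim w
        (cfg 1 0 0 : Cell (ℓ + k) (Sub ℓ k) → Fin 2)))
      (fun w => ket (Sum.elim w (cfg 0 0 0))) := by
    refine maps_not_of (Sum.inr (Sum.inl ())) (fun _ => rfl) ?_
    rintro w (q | q | q | q) hq
    all_goals first | rfl | exact absurd rfl hq
  have b := Maps.sum (fun _ : Unit => (Finset.univ : Finset (Fin (ℓ + k) → Fin 2)))
    (fun _ w => w) (fun _ w => ψ w)
    ((((((b1.trans b2).trans b3).trans b4).trans b5).trans b6).trans b7)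
  obtain ⟨C, hC, h⟩ := (a0.trans a1).trans b
  refine ⟨D, hD, C, hC.trans (by omega), ?_⟩
  have h := h ()
  simp only [cfg_zero] at h
  rw [ketZero_eq_ket, ketZero_eq_ket, tensor_ket]
  refine h.trans ?_
  conv_rhs => rw [eq_sum_ket ψ]
  simp only [tensor_sum_left, tensor_smul_left, tensor_ket]

/-! ### State preparation without ancillary qubits -/

/-- One rotation sets the weights of the two halves of `ψ`; the first qubit then controls the
preparation of the others. -/
theorem exists_circuit_no_ancilla (n : ℕ) (hn : 1 ≤ n) (ψ : Amplitudes (Fin n))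
    (hψ : IsState ψ) :
    ∃ C : Circuit (Fin n), C.depth * n ≤ 150 * 2 ^ n ∧ C.apply (ketZero _) = ψ := by
  obtain ⟨ℓ, rfl⟩ : ∃ ℓ, n = ℓ + 1 := ⟨n - 1, by omega⟩
  obtain ⟨θ, ψ₀, ψ₁, h₀, h₁, e₀, e₁⟩ := exists_split ψ hψ
  obtain ⟨D, hD, h⟩ := exists_maps_prepare ℓ (fun f => if f = 0 then ψ₀ else ψ₁) (fun f => by
    split_ifs
    · exact h₀
    · exact h₁)
  let e : Unit ⊕ Fin ℓ ≃ Fin (ℓ + 1) := Equiv.ofBijective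
    (Sum.elim (fun _ => 0) Fin.succ) (by
      rw [Fintype.bijective_iff_injective_and_card]
      constructor
      · rintro (i | i) (j | j) h
        · rfl
        · exact absurd h (Fin.succ_ne_zero j).symm
        · exact absurd h (Fin.succ_ne_zero i)
        · exact congrArg Sum.inr (Fin.succ_injective _ h)
      · simp [add_comm])
  have he : ∀ f (y : Fin ℓ → Fin 2), Sum.elim (bit f) y ∘ e.symm =
      (Fin.cons f y : Fin (ℓ + 1) → Fin 2) := by
    intro f y
    rw [Equiv.comp_symm_eq]
    funext q
    rcases q with q | q <;> rfl
  have h1 := (h.relabel e).congr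
    (s' := fun f => ket (Fin.cons f 0 : Fin (ℓ + 1) → Fin 2))
    (t' := fun f => ∑ y, (if f = 0 then ψ₀ else ψ₁) y • ket (Fin.cons f y : Fin (ℓ + 1) → Fin 2))
    (fun f => by rw [relabel_ket, he]) (fun f => by
      simp only [relabel_sum, relabel_smul, relabel_ket, he])
  obtain ⟨D', hD', h'⟩ := exists_maps_rotation fun _ : Fin 0 → Fin 2 => θ
  let g : Fin 0 ⊕ Unit ↪ Fin (ℓ + 1) := ⟨fun _ => 0, by
    rintro (i | i) (j | j) h
    · exact i.elim0
    · exact i.elim0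
    · exact j.elim0
    · rfl⟩
  have hg : ∀ b, extend g (ket (app (0 : Fin 0 → Fin 2) b)) 0 =
      ket (Fin.cons b 0 : Fin (ℓ + 1) → Fin 2) := by
    intro b
    refine extend_ket g _ _ _ ?_ ?_
    · rintro (q | q)
      · exact q.elim0
      · rfl
    · intro p
      induction p using Fin.cases with
      | zero => exact fun hp => absurd ⟨Sum.inr (), rfl⟩ hp
      | succ p => intro _; rw [Fin.cons_succ]; rfl
  have h2 : Maps D' (fun _ : Unit => ket (0 : Fin (ℓ + 1) → Fin 2))
      (fun _ => ∑ b, (if b = 0 then (Real.cos θ : ℂ) else (Real.sin θ : ℂ)) •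
        ket (Fin.cons b 0 : Fin (ℓ + 1) → Fin 2)) := by
    refine ((h'.extend g).comp fun _ => (0, 0)).congr (fun _ => ?_) fun _ => ?_
    · rw [hg]
      congr 1
      funext i
      induction i using Fin.cases <;> rfl
    · rw [extend_add, extend_smul, extend_smul, hg, hg, Fin.sum_univ_two]
      simp
  have h3 := h1.sum (fun _ : Unit => (Finset.univ : Finset (Fin 2))) (fun _ b => b)
    (fun _ b => (if b = 0 then (Real.cos θ : ℂ) else (Real.sin θ : ℂ)))
  obtain ⟨C, hC, h4⟩ := h2.trans h3
  refine ⟨C, ?_, ?_⟩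
  · simp only [Fintype.card_fin] at hD'
    have h2ℓ : ℓ < 2 ^ ℓ := Nat.lt_two_pow_self
    calc C.depth * (ℓ + 1) ≤ (D' + D) * (ℓ + 1) := by gcongr
      _ ≤ (30 + D) * (ℓ + 1) := by gcongr; omega
      _ ≤ 150 * 2 ^ (ℓ + 1) := by rw [pow_succ]; nlinarith
  · rw [ketZero_eq_ket]
    refine (h4 ()).trans ?_
    conv_rhs => rw [eq_sum_ket ψ]
    rw [sum_eq_sum_cons, Fin.sum_univ_two]
    simp only [if_true, Fin.isValue, one_ne_zero, if_false, Finset.smul_sum, smul_smul, e₀, e₁]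

/-! ### Upper bounds -/

theorem exists_prepares_of_ancilla {n m : ℕ} {T : Type} [Fintype T] [DecidableEq T]
    (hT : Fintype.card T ≤ m) (C : Circuit (Fin n ⊕ T)) (ψ : Amplitudes (Fin n))
    (hC : C.apply (tensor (ketZero _) (ketZero _)) = tensor ψ (ketZero _)) :
    ∃ C' : Circuit (Fin n ⊕ Fin m), Prepares C' ψ ∧ C'.depth = C.depth ∧ C'.size = C.size := by
  obtain ⟨g⟩ : Nonempty (T ↪ Fin m) :=
    Function.Embedding.nonempty_of_card_le (by rwa [Fintype.card_fin])
  let f : Fin n ⊕ T ↪ Fin n ⊕ Fin m := (Function.Embedding.refl _).sumMap g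
  have hket : ∀ y : Fin n → Fin 2, extend f (ket (Sum.elim y 0)) 0 = ket (Sum.elim y 0) := by
    intro y
    refine extend_ket f _ _ _ ?_ ?_
    · rintro (q | q) <;> rfl
    · rintro (q | q) hq
      · exact absurd ⟨Sum.inl q, rfl⟩ hq
      · rfl
  have hext : ∀ φ : Amplitudes (Fin n),
      extend f (tensor φ (ketZero T)) 0 = tensor φ (ketZero (Fin m)) := by
    intro φ
    conv_lhs => rw [eq_sum_ket φ]
    conv_rhs => rw [eq_sum_ket φ]
    simp only [ketZero_eq_ket, tensor_sum_left, tensor_smul_left, tensor_ket, extend_sum,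
      extend_smul, hket]
  refine ⟨C.map f, ?_, C.depth_map f, C.size_map f⟩
  rw [Prepares, ← hext, Circuit.map_apply_extend, hC, hext]

theorem exists_prepares_of_no_ancilla {n : ℕ} (m : ℕ) (C : Circuit (Fin n))
    (ψ : Amplitudes (Fin n)) (hC : C.apply (ketZero _) = ψ) :
    ∃ C' : Circuit (Fin n ⊕ Fin m), Prepares C' ψ ∧ C'.depth = C.depth ∧ C'.size = C.size := by
  let f : Fin n ↪ Fin n ⊕ Fin m := Function.Embedding.inl
  have hket : ∀ y : Fin n → Fin 2, extend f (ket y) 0 = ket (Sum.elim y 0) := by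
    intro y
    refine extend_ket f _ _ _ (fun _ => rfl) ?_
    rintro (q | q) hq
    · exact absurd ⟨q, rfl⟩ hq
    · rfl
  have hext : ∀ φ : Amplitudes (Fin n), extend f φ 0 = tensor φ (ketZero (Fin m)) := by
    intro φ
    conv_lhs => rw [eq_sum_ket φ]
    conv_rhs => rw [eq_sum_ket φ]
    simp only [ketZero_eq_ket, tensor_sum_left, tensor_smul_left, tensor_ket, extend_sum,
      extend_smul, hket]
  refine ⟨C.map f, ?_, C.depth_map f, C.size_map f⟩
  rw [Prepares, ← hext, Circuit.map_apply_extend, hC, hext]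

theorem mul_self_le_two_mul_two_pow (n : ℕ) : n * n ≤ 2 * 2 ^ n := by
  rcases Nat.lt_or_ge n 3 with h | h
  · interval_cases n <;> norm_num
  · induction n, h using Nat.le_induction with
    | base => norm_num
    | succ n hn ih =>
      rw [pow_succ]
      nlinarith

theorem exists_and_not_succ {P : ℕ → Prop} {n : ℕ} (h0 : P 0) (hn : ¬ P n) :
    ∃ k, P k ∧ ¬ P (k + 1) := by
  by_contra! h
  exact hn (Nat.rec h0 (fun k hk => h k hk) n)

/-- Here n + m < 8n, so ignoring the ancillas costs only a constant factor. -/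
theorem exists_prepares_small {n m : ℕ} (hn : 1 ≤ n) (hm : m < 7 * n)
    (ψ : Amplitudes (Fin n)) (hψ : IsState ψ) :
    ∃ C : Circuit (Fin n ⊕ Fin m), Prepares C ψ ∧
      (C.depth : ℝ) ≤ 3600 * ((n : ℝ) + (2 : ℝ) ^ n / ((n : ℝ) + (m : ℝ))) ∧
      (C.size : ℝ) ≤ 3600 * (2 : ℝ) ^ n := by
  obtain ⟨C₀, hd, h⟩ := exists_circuit_no_ancilla n hn ψ hψ
  obtain ⟨C, hC, hCd, hCs⟩ := exists_prepares_of_no_ancilla m C₀ ψ h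
  have hs := C₀.size_le
  rw [Fintype.card_fin] at hs
  rw [← hCd] at hd hs
  rw [← hCs] at hs
  refine ⟨C, hC, ?_, ?_⟩
  · have hn' : (0 : ℝ) < n := by exact_mod_cast hn
    have hd' : (C.depth : ℝ) * n ≤ 150 * 2 ^ n := by exact_mod_cast hd
    have hm' : (m : ℝ) < 7 * n := by exact_mod_cast hm
    have h1 : (C.depth : ℝ) ≤ 1200 * (2 ^ n / ((n : ℝ) + m)) := by
      rw [← mul_div_assoc, le_div_iff₀ (by positivity)]
      have : (0 : ℝ) ≤ C.depth := by positivity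
      nlinarith
    have h2 : (0 : ℝ) ≤ 2 ^ n / ((n : ℝ) + m) := by positivity
    linarith
  · have : (C.size : ℝ) ≤ 150 * 2 ^ n := by exact_mod_cast hs.trans hd
    have h2 : (0 : ℝ) ≤ 2 ^ n := by positivity
    linarith

theorem exists_prepares_large {ℓ k m : ℕ} (hℓ : 1 ≤ ℓ) (hm : 7 * (2 ^ k * ℓ) ≤ m)
    (hnℓ : (ℓ + k) * ℓ ≤ 2 * 2 ^ ℓ)
    (hmax : ℓ = 1 ∨ m < 14 * (2 ^ k * ℓ) ∨ 2 ^ ℓ ≤ (ℓ + k) * ℓ)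
    (ψ : Amplitudes (Fin (ℓ + k))) (hψ : IsState ψ) :
    ∃ C : Circuit (Fin (ℓ + k) ⊕ Fin m), Prepares C ψ ∧
      (C.depth : ℝ) ≤ 3600 * (((ℓ + k : ℕ) : ℝ) +
        (2 : ℝ) ^ (ℓ + k) / (((ℓ + k : ℕ) : ℝ) + (m : ℝ))) ∧
      (C.size : ℝ) ≤ 3600 * (2 : ℝ) ^ (ℓ + k) := by
  obtain ⟨D, hD, C₀, hd, h⟩ := exists_circuit_tree ℓ k ψ hψ
  have hcard := card_cell_sub ℓ k
  have h7 : (3 * ℓ + 4) * 2 ^ k ≤ 7 * (2 ^ k * ℓ) := by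
    have : 1 ≤ 2 ^ k := Nat.one_le_two_pow
    nlinarith
  obtain ⟨C, hC, hCd, hCs⟩ := exists_prepares_of_ancilla (m := m) (by omega) C₀ ψ h
  have hs := C₀.size_le
  rw [Fintype.card_sum, Fintype.card_fin] at hs
  rw [← hCd] at hd hs
  rw [← hCs] at hs
  have hn : ℓ + k ≤ 2 ^ k * ℓ := by
    have : k + 1 ≤ 2 ^ k := Nat.lt_two_pow_self
    nlinarith
  have hd90 : C.depth ≤ D + 90 * (ℓ + k) := by omega
  refine ⟨C, hC, ?_, ?_⟩
  · set n : ℝ := ((ℓ + k : ℕ) : ℝ) with hn_def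
    set M : ℝ := (2 : ℝ) ^ (ℓ + k) / (n + m) with hM
    have hn1 : 1 ≤ n := by
      rw [hn_def]
      exact_mod_cast (by omega : 1 ≤ ℓ + k)
    have hM0 : 0 ≤ M := by positivity
    have hℓ' : (1 : ℝ) ≤ ℓ := by exact_mod_cast hℓ
    have hD' : (D : ℝ) * (ℓ + 1) ≤ 232 * 2 ^ ℓ := by exact_mod_cast hD
    -- `D` is of order 2^ℓ/ℓ. It is a constant if `ℓ = 1`, is of order 2^n/(n+m) if the tree fills a
    -- fixed fraction of the ancillas, and is O(n) if 2^ℓ ≤ nℓ. The constant is 232·15.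
    have hDM : (D : ℝ) ≤ 3480 * (n + M) := by
      rcases hmax with rfl | hm14 | h2
      · norm_num at hD'
        nlinarith
      · have e1 : n + m ≤ 15 * (2 ^ k * ℓ) := by
          rw [hn_def]
          exact_mod_cast (by omega : ℓ + k + m ≤ 15 * (2 ^ k * ℓ))
        have e2 : (2 : ℝ) ^ ℓ ≤ 15 * (M * ℓ) := by
          have e3 : M * (n + m) = 2 ^ (ℓ + k) := div_mul_cancel₀ _ (by positivity)
          rw [pow_add] at e3
          have e4 : (2 : ℝ) ^ ℓ * 2 ^ k ≤ 15 * (M * ℓ) * 2 ^ k := by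
            rw [← e3]
            nlinarith [mul_le_mul_of_nonneg_left e1 hM0]
          exact le_of_mul_le_mul_right e4 (by positivity)
        have e5 : (D : ℝ) * ℓ ≤ 3480 * M * ℓ := by
          have : (0 : ℝ) ≤ D := by positivity
          nlinarith
        have e6 := le_of_mul_le_mul_right e5 (by linarith)
        nlinarith
      · have e1 : (2 : ℝ) ^ ℓ ≤ n * ℓ := by
          rw [hn_def]
          exact_mod_cast h2
        have e5 : (D : ℝ) * ℓ ≤ 232 * n * ℓ := by
          have : (0 : ℝ) ≤ D := by positivity
          nlinarith
        have e6 := le_of_mul_le_mul_right e5 (by linarith)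
        nlinarith
    have hd' : (C.depth : ℝ) ≤ D + 90 * n := by
      rw [hn_def]
      exact_mod_cast hd90
    nlinarith
  · have hq : ℓ + k + Fintype.card (Cell (ℓ + k) (Sub ℓ k)) ≤ 8 * (2 ^ k * ℓ) := by omega
    have : C.size ≤ 3600 * 2 ^ (ℓ + k) := by
      calc C.size ≤ C.depth * (ℓ + k + Fintype.card (Cell (ℓ + k) (Sub ℓ k))) := hs
        _ ≤ (D + 90 * (ℓ + k)) * (8 * (2 ^ k * ℓ)) := by gcongr
        _ = 8 * 2 ^ k * (D * ℓ) + 720 * 2 ^ k * ((ℓ + k) * ℓ) := by ring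
        _ ≤ 8 * 2 ^ k * (232 * 2 ^ ℓ) + 720 * 2 ^ k * (2 * 2 ^ ℓ) :=
          Nat.add_le_add (Nat.mul_le_mul_left _
            ((Nat.mul_le_mul_left _ (Nat.le_succ _)).trans hD)) (Nat.mul_le_mul_left _ hnℓ)
        _ = 3296 * 2 ^ (ℓ + k) := by rw [pow_add]; ring
        _ ≤ 3600 * 2 ^ (ℓ + k) := Nat.mul_le_mul_right _ (by norm_num)
    exact_mod_cast this

theorem exists_prepares (n m : ℕ) (hn : 1 ≤ n) (ψ : Amplitudes (Fin n)) (hψ : IsState ψ) :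
    ∃ C : Circuit (Fin n ⊕ Fin m), Prepares C ψ ∧
      (C.depth : ℝ) ≤ 3600 * ((n : ℝ) + (2 : ℝ) ^ n / ((n : ℝ) + (m : ℝ))) ∧
      (C.size : ℝ) ≤ 3600 * (2 : ℝ) ^ n := by
  by_cases hm : m < 7 * n
  · exact exists_prepares_small hn hm ψ hψ
  -- The conditions say that leaves are nonempty, that the tree fits into the ancillas, and that
  -- O(n) layers on 2^k ℓ qubits have O(2^n) gates. Whichever fails at `k + 1` gives a case of
  -- `hmax`.
  · obtain ⟨k, ⟨hk, hkm, hkn⟩, hk'⟩ := exists_and_not_succ (n := n)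
      (P := fun k => k < n ∧ 7 * (2 ^ k * (n - k)) ≤ m ∧ n * (n - k) ≤ 2 * 2 ^ (n - k))
      ⟨hn, by simpa using hm, by simpa using mul_self_le_two_mul_two_pow n⟩
      (fun h => lt_irrefl _ h.1)
    obtain ⟨ℓ, rfl⟩ : ∃ ℓ, n = ℓ + k := ⟨n - k, by omega⟩
    rw [Nat.add_sub_cancel] at hkm hkn
    refine exists_prepares_large (by omega) hkm hkn ?_ ψ hψ
    by_contra! hcon
    obtain ⟨c1, c2, c3⟩ := hcon
    obtain ⟨j, rfl⟩ : ∃ j, ℓ = j + 1 := ⟨ℓ - 1, by omega⟩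
    refine hk' ⟨by omega, ?_, ?_⟩
    · have : j + 1 + k - (k + 1) = j := by omega
      rw [this, pow_succ]
      nlinarith
    · have : j + 1 + k - (k + 1) = j := by omega
      rw [this]
      rw [pow_succ] at c3
      nlinarith

section LightCone

variable {Q : Type} [DecidableEq Q]

/-! ### Light cones -/

theorem Gate.apply_comm (g h : Gate Q) (hd : Disjoint g.support h.support) (ψ : Amplitudes Q) :
    g.apply (h.apply ψ) = h.apply (g.apply ψ) := by
  funext x
  cases g with
  | single q U =>
    cases h with
    | single p V =>
      simp only [Gate.support, Finset.disjoint_singleton] at hd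
      simp only [Gate.apply, Function.update_of_ne hd, Function.update_of_ne hd.symm,
        Finset.mul_sum]
      rw [Finset.sum_comm]
      refine Finset.sum_congr rfl fun b _ => Finset.sum_congr rfl fun a _ => ?_
      rw [Function.update_comm hd]
      ring
    | cnot c t hct =>
      simp only [Gate.support, Finset.disjoint_singleton_left, Finset.mem_insert,
        Finset.mem_singleton, not_or] at hd
      simp only [Gate.apply, Function.update_of_ne hd.2, Function.update_of_ne (Ne.symm hd.1),
        Function.update_of_ne (Ne.symm hd.2)]
      refine Finset.sum_congr rfl fun b _ => ?_
      rw [Function.update_comm hd.2]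
  | cnot c t hct =>
    cases h with
    | single q V =>
      simp only [Gate.support, Finset.disjoint_singleton_right, Finset.mem_insert,
        Finset.mem_singleton, not_or] at hd
      simp only [Gate.apply, Function.update_of_ne hd.2, Function.update_of_ne (Ne.symm hd.1),
        Function.update_of_ne (Ne.symm hd.2)]
      refine Finset.sum_congr rfl fun b _ => ?_
      rw [Function.update_comm hd.2]
    | cnot c' t' hct' =>
      simp only [Gate.support, Finset.disjoint_insert_left, Finset.disjoint_singleton_left,
        Finset.mem_insert, Finset.mem_singleton, not_or] at hd
      obtain ⟨⟨-, h2⟩, h3, h4⟩ := hd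
      simp only [Gate.apply, Function.update_of_ne h2, Function.update_of_ne h4,
        Function.update_of_ne (Ne.symm h3), Function.update_of_ne (Ne.symm h4)]
      rw [Function.update_comm h4]

theorem apply_run_comm (g : Gate Q) (l : List (Gate Q))
    (hd : ∀ h ∈ l, Disjoint g.support h.support) (ψ : Amplitudes Q) :
    g.apply (run l ψ) = run l (g.apply ψ) := by
  induction l generalizing ψ with
  | nil => rfl
  | cons h l ih =>
    rw [run_cons, ih (fun h' hh => hd h' (List.mem_cons_of_mem _ hh)), run_cons,
      Gate.apply_comm g h (hd h List.mem_cons_self)]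

theorem run_run_comm (l l' : List (Gate Q))
    (hd : ∀ g ∈ l, ∀ h ∈ l', Disjoint g.support h.support) (ψ : Amplitudes Q) :
    run l (run l' ψ) = run l' (run l ψ) := by
  induction l generalizing ψ with
  | nil => rfl
  | cons g l ih =>
    rw [run_cons, apply_run_comm g l' (hd g List.mem_cons_self),
      ih (fun h hh => hd h (List.mem_cons_of_mem _ hh)), run_cons]

theorem run_eq_run_filter (P : Gate Q → Prop) [DecidablePred P] (l : List (Gate Q))
    (hl : l.Pairwise (fun g h => Disjoint g.support h.support)) (ψ : Amplitudes Q) :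
    run l ψ = run (l.filter (fun g => ¬ P g)) (run (l.filter (fun g => P g)) ψ) := by
  induction l generalizing ψ with
  | nil => rfl
  | cons g l ih =>
    obtain ⟨hg, hl⟩ := List.pairwise_cons.1 hl
    rw [run_cons, ih hl]
    by_cases h : P g
    · simp [h]
    · simp only [List.filter_cons, h, decide_false, not_false_eq_true, decide_true, if_true,
        run_cons]
      rw [apply_run_comm g]
      · rfl
      · exact fun h hh => hg h (List.mem_of_mem_filter hh)

theorem Gate.card_support_le (g : Gate Q) : g.support.card ≤ 2 := by
  cases g with
  | single q U => simp [Gate.support]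
  | cnot c t h => exact Finset.card_le_two

theorem length_le_card_of_pairwise_disjoint (l : List (Gate Q)) (S : Finset Q)
    (hl : l.Pairwise (fun g h => Disjoint g.support h.support))
    (hS : ∀ g ∈ l, ¬ Disjoint g.support S) : l.length ≤ S.card := by
  induction l generalizing S with
  | nil => simp
  | cons g l ih =>
    obtain ⟨hg, hl⟩ := List.pairwise_cons.1 hl
    obtain ⟨q, hq, hqS⟩ := Finset.not_disjoint_iff.1 (hS g List.mem_cons_self)
    have := ih (S.erase q) hl fun h hh => by
      obtain ⟨p, hp, hpS⟩ := Finset.not_disjoint_iff.1 (hS h (List.mem_cons_of_mem _ hh))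
      refine Finset.not_disjoint_iff.2 ⟨p, hp, Finset.mem_erase.2 ⟨?_, hpS⟩⟩
      rintro rfl
      exact Finset.disjoint_left.1 (hg h hh) hq hp
    rw [Finset.card_erase_of_mem hqS] at this
    have := Finset.card_pos.2 ⟨q, hqS⟩
    rw [List.length_cons]
    omega

/-- Each gate touching `S` contributes at most one further qubit, as it acts on at most two. One
layer thus at most doubles the light cone. -/
theorem exists_superset_supports (l : List (Gate Q)) (S : Finset Q)
    (hS : ∀ g ∈ l, ¬ Disjoint g.support S) :
    ∃ T : Finset Q, S ⊆ T ∧ (∀ g ∈ l, g.support ⊆ T) ∧ T.card ≤ S.card + l.length := by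
  induction l with
  | nil => exact ⟨S, subset_rfl, by simp, by simp⟩
  | cons g l ih =>
    obtain ⟨T, hST, hT, hc⟩ := ih fun h hh => hS h (List.mem_cons_of_mem _ hh)
    obtain ⟨q, hq, hqS⟩ := Finset.not_disjoint_iff.1 (hS g List.mem_cons_self)
    refine ⟨g.support ∪ T, hST.trans Finset.subset_union_right, ?_, ?_⟩
    · intro h hh
      rcases List.mem_cons.1 hh with rfl | hh
      · exact Finset.subset_union_left
      · exact (hT h hh).trans Finset.subset_union_right
    · have h1 := Finset.card_union_add_card_inter g.support T
      have h2 := Finset.card_pos.2 ⟨q, Finset.mem_inter.2 ⟨hq, hST hqS⟩⟩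
      have h3 := g.card_support_le
      rw [List.length_cons]
      omega

/-- Up to gates that do not act on `S`, a circuit of depth `d` consists of at most
`|S| (2 ^ d - 1)` gates. -/
theorem exists_run_run_of_layers (Ls : List (Layer Q)) (S : Finset Q) :
    ∃ G B : List (Gate Q), G.length + S.card ≤ S.card * 2 ^ Ls.length ∧
      (∀ g ∈ B, Disjoint g.support S) ∧
      ∀ ψ, Ls.foldl (fun φ L => L.apply φ) ψ = run B (run G ψ) := by
  induction Ls using List.reverseRecOn generalizing S with
  | nil => exact ⟨[], [], by simp, by simp, fun ψ => rfl⟩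
  | append_singleton Ls L ih =>
    -- The induction peels off the last layer. Its gates meeting `S` enlarge `S` to `T`; the earlier
    -- gates in `B` avoid `T`, so they commute past `hits`.
    set hits := L.gates.filter (fun g => ¬ Disjoint g.support S) with hhits
    set rest := L.gates.filter (fun g => ¬ ¬ Disjoint g.support S) with hrest
    have hh : ∀ g ∈ hits, ¬ Disjoint g.support S := fun g hg => by
      simpa using (List.mem_filter.1 hg).2
    have hlen := length_le_card_of_pairwise_disjoint hits S (L.disjoint.filter _) hh
    obtain ⟨T, hST, hT, hc⟩ := exists_superset_supports hits S hh
    obtain ⟨G, B, hG, hB, hGB⟩ := ih T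
    refine ⟨G ++ hits, B ++ rest, ?_, ?_, fun ψ => ?_⟩
    · have h2 : T.card * (2 ^ Ls.length - 1) ≤ (2 * S.card) * (2 ^ Ls.length - 1) :=
        Nat.mul_le_mul_right _ (by omega)
      obtain ⟨j, hj⟩ : ∃ j, 2 ^ Ls.length = j + 1 :=
        ⟨2 ^ Ls.length - 1, (Nat.sub_add_cancel Nat.one_le_two_pow).symm⟩
      rw [List.length_append, List.length_append, List.length_singleton, pow_succ, hj]
      rw [hj] at hG h2
      simp only [Nat.add_sub_cancel] at h2
      nlinarith
    · intro g hg
      rcases List.mem_append.1 hg with hg | hg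
      · exact (hB g hg).mono_right hST
      · simpa using (List.mem_filter.1 hg).2
    · rw [List.foldl_append, hGB, List.foldl_cons, List.foldl_nil, Layer.apply_eq_run,
        run_eq_run_filter (fun g => ¬ Disjoint g.support S) L.gates L.disjoint, run_append,
        run_append]
      change run rest (run hits _) = run rest _
      rw [run_run_comm hits B]
      exact fun g hg h hh => ((hB h hh).mono_right (hT g hg)).symm

theorem exists_eq_map_inr {A B : Type} [DecidableEq A] [DecidableEq B] [Fintype A]
    (l : List (Gate (A ⊕ B)))
    (hl : ∀ g ∈ l, Disjoint g.support (Finset.univ.map Function.Embedding.inl)) :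
    ∃ l' : List (Gate B), l = l'.map (Gate.map Function.Embedding.inr) := by
  induction l with
  | nil => exact ⟨[], rfl⟩
  | cons g l ih =>
    obtain ⟨l', rfl⟩ := ih fun h hh => hl h (List.mem_cons_of_mem _ hh)
    have hg := hl g List.mem_cons_self
    have key : ∀ q ∈ g.support, ∃ b, q = Sum.inr b := by
      intro q hq
      rcases q with a | b
      · exact absurd (Finset.mem_map.2 ⟨a, Finset.mem_univ _, rfl⟩)
          (Finset.disjoint_left.1 hg hq)
      · exact ⟨b, rfl⟩
    cases g with
    | single q U =>
      obtain ⟨b, rfl⟩ := key q (by simp [Gate.support])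
      exact ⟨Gate.single b U :: l', rfl⟩
    | cnot c t h =>
      obtain ⟨c, rfl⟩ := key c (by simp [Gate.support])
      obtain ⟨t, rfl⟩ := key t (by simp [Gate.support])
      exact ⟨Gate.cnot c t (fun e => h (congrArg _ e)) :: l', rfl⟩

/-- The gates outside the light cone act on ancillas only. Undoing them shows that the light cone
alone produces a product `ψ ⊗ χ`, and `ψ` is a multiple of its slice at any `y` with `χ y ≠ 0`. -/
theorem Prepares.exists_run {n m : ℕ} {C : Circuit (Fin n ⊕ Fin m)} {ψ : Amplitudes (Fin n)}
    (h : Prepares C ψ) (hψ : ψ ≠ 0) :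
    ∃ (G : List (Gate (Fin n ⊕ Fin m))) (a : ℂ) (y : Fin m → Fin 2),
      G.length + n ≤ n * 2 ^ C.depth ∧
      ψ = fun x => a * run G (tensor (ketZero (Fin n)) (ketZero (Fin m))) (Sum.elim x y) := by
  obtain ⟨G, B, hG, hB, hGB⟩ := exists_run_run_of_layers C.layers
    (Finset.univ.map (Function.Embedding.inl : Fin n ↪ Fin n ⊕ Fin m))
  rw [Finset.card_map, Finset.card_univ, Fintype.card_fin] at hG
  obtain ⟨B', rfl⟩ := exists_eq_map_inr B hB
  have h1 := (hGB _).symm.trans h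
  set X := run G (tensor (ketZero (Fin n)) (ketZero (Fin m))) with hX
  obtain ⟨B'', hB''⟩ := exists_eq_map_inr
    ((B'.map (Gate.map (Function.Embedding.inr : Fin m ↪ Fin n ⊕ Fin m))).map Gate.inv).reverse
    (by
      intro g hg
      obtain ⟨g', hg', rfl⟩ := List.mem_map.1 (List.mem_reverse.1 hg)
      rw [Gate.support_inv]
      exact hB g' hg')
  have h2 := run_inv_run (B'.map (Gate.map (Function.Embedding.inr : Fin m ↪ Fin n ⊕ Fin m))) X
  rw [h1, hB'', run_map_inr_tensor] at h2
  set χ := run B'' (ketZero (Fin m)) with hχ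
  have hχ0 : χ ≠ 0 := by
    intro h0
    have hX0 : X = (0 : ℂ) • X := by
      rw [← h2, h0]
      funext x
      simp [tensor]
    rw [hX0, run_smul, zero_smul] at h1
    refine hψ (funext fun x => ?_)
    have := congrFun h1 (Sum.elim x 0)
    simpa [tensor, ketZero, funext_iff] using this.symm
  obtain ⟨y, hy⟩ := Function.ne_iff.1 hχ0
  refine ⟨G, (χ y)⁻¹, y, hG, funext fun x => ?_⟩
  rw [← hX, ← h2]
  simp only [tensor, Sum.elim_inl, Sum.elim_inr]
  have : χ y ≠ 0 := hy
  field_simp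

end LightCone

section Counting

variable {Q : Type} [DecidableEq Q]

/-! ### Parameter counting -/

/-- The shape of a gate: the qubits on which it acts, without the unitary. -/
def Gate.shape : Gate Q → Q ⊕ Q × Q
  | .single q _ => Sum.inl q
  | .cnot c t _ => Sum.inr (c, t)

/-- The states obtained by running gates of prescribed shapes are parametrized by a smooth map
with eight real parameters per gate. -/
theorem exists_contDiff_run [Fintype Q] (ψ : Amplitudes Q) (l : List (Q ⊕ Q × Q)) :
    ∃ F : (Fin l.length → Fin 2 → Fin 2 → ℂ) → Amplitudes Q, ContDiff ℝ 1 F ∧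
      ∀ G : List (Gate Q), G.map Gate.shape = l → ∃ p, F p = run G.reverse ψ := by
  induction l with
  | nil =>
    refine ⟨fun _ => ψ, contDiff_const, fun G hG => ⟨0, ?_⟩⟩
    rw [List.map_eq_nil_iff.1 hG]
    rfl
  | cons s l ih =>
    obtain ⟨F, hF, hrun⟩ := ih
    have htail : ContDiff ℝ 1 fun p : Fin (s :: l).length → Fin 2 → Fin 2 → ℂ =>
        F (fun i => p i.succ) := hF.comp (by fun_prop)
    have hcoord : ∀ x, ContDiff ℝ 1 fun p : Fin (s :: l).length → Fin 2 → Fin 2 → ℂ =>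
        F (fun i => p i.succ) x := contDiff_pi.1 htail
    rcases s with q | ⟨c, t⟩
    -- Unitarity is dropped: an arbitrary complex 2×2 matrix makes the parameter space linear and
    -- only enlarges the image.
    · refine ⟨fun p x => ∑ b : Fin 2, p (0 : Fin (l.length + 1)) (x q) b *
        F (fun i => p i.succ) (Function.update x q b), ?_, fun G hG => ?_⟩
      · refine contDiff_pi.2 fun x => ContDiff.sum fun b _ => ContDiff.mul ?_ (hcoord _)
        fun_prop
      · obtain ⟨g, G, rfl, hg, hG⟩ := List.map_eq_cons_iff.1 hG
        obtain ⟨p, hp⟩ := hrun G hG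
        cases g with
        | cnot c t h => simp [Gate.shape] at hg
        | single q' U =>
          obtain rfl : q' = q := Sum.inl_injective hg
          refine ⟨Fin.cons (α := fun _ : Fin (l.length + 1) => Fin 2 → Fin 2 → ℂ)
            (fun a b => U.1 a b) p, ?_⟩
          rw [List.reverse_cons, run_append, ← hp]
          rfl
    · refine ⟨fun p x => F (fun i => p i.succ) (Function.update x t (x t + x c)),
        contDiff_pi.2 fun x => hcoord _, fun G hG => ?_⟩
      obtain ⟨g, G, rfl, hg, hG⟩ := List.map_eq_cons_iff.1 hG
      obtain ⟨p, hp⟩ := hrun G hG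
      cases g with
      | single q U => simp [Gate.shape] at hg
      | cnot c' t' h =>
        obtain ⟨rfl, rfl⟩ : c' = c ∧ t' = t := by simpa [Gate.shape] using hg
        -- A CNOT has no parameters; its slot is filled arbitrarily.
        refine ⟨Fin.cons (α := fun _ : Fin (l.length + 1) => Fin 2 → Fin 2 → ℂ) 0 p, ?_⟩
        rw [List.reverse_cons, run_append, ← hp]
        rfl

theorem finrank_parameters (N : ℕ) :
    Module.finrank ℝ (ℂ × (Fin N → Fin 2 → Fin 2 → ℂ)) = 8 * N + 2 := by
  simp [Module.finrank_prod, Module.finrank_pi_fintype, Complex.finrank_real_complex]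
  ring

/-- A C¹ map does not raise Hausdorff dimension above that of its source, and a countable union
takes the supremum. The scalar `a` makes the exceptional set closed under scaling, so a missed
vector may be normalized. -/
theorem exists_state_forall_run_ne (n m : ℕ) (hn : 1 ≤ n) :
    ∃ ψ : Amplitudes (Fin n), IsState ψ ∧
      ∀ (G : List (Gate (Fin n ⊕ Fin m))) (a : ℂ) (y : Fin m → Fin 2),
        ψ = (fun x => a * run G (tensor (ketZero (Fin n)) (ketZero (Fin m))) (Sum.elim x y)) →
        2 ^ (n + 1) ≤ 8 * G.length + 2 := by
  choose F hF hrun using exists_contDiff_run (tensor (ketZero (Fin n)) (ketZero (Fin m)))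
  let R (l : List ((Fin n ⊕ Fin m) ⊕ (Fin n ⊕ Fin m) × (Fin n ⊕ Fin m))) (y : Fin m → Fin 2)
      (p : ℂ × (Fin l.length → Fin 2 → Fin 2 → ℂ)) : Amplitudes (Fin n) :=
    fun x => p.1 * F l p.2 (Sum.elim x y)
  have hR : ∀ l y, ContDiff ℝ 1 (R l y) := by
    intro l y
    refine contDiff_pi.2 fun x => contDiff_fst.mul ?_
    exact (contDiff_pi.1 (hF l) _).comp contDiff_snd
  have hfin : Module.finrank ℝ (Amplitudes (Fin n)) = 2 ^ (n + 1) := by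
    simp [Module.finrank_pi_fintype, Complex.finrank_real_complex, pow_succ]
  have hdim : dimH (⋃ (l) (_ : 8 * l.length + 2 < 2 ^ (n + 1)) (y), Set.range (R l y)) <
      dimH (Set.univ : Set (Amplitudes (Fin n))) := by
    rw [Real.dimH_univ_eq_finrank, hfin]
    have : dimH (⋃ (l) (_ : 8 * l.length + 2 < 2 ^ (n + 1)) (y), Set.range (R l y)) ≤
        ((2 ^ (n + 1) - 1 : ℕ) : ENNReal) := by
      simp only [dimH_iUnion, iSup_le_iff]
      intro l hl y
      refine ((hR l y).dimH_range_le).trans ?_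
      rw [finrank_parameters]
      exact_mod_cast (by omega : 8 * l.length + 2 ≤ 2 ^ (n + 1) - 1)
    refine this.trans_lt ?_
    exact_mod_cast Nat.sub_lt (by positivity) one_pos
  obtain ⟨φ, hφ⟩ : ∃ φ, φ ∉ ⋃ (l) (_ : 8 * l.length + 2 < 2 ^ (n + 1)) (y),
      Set.range (R l y) := by
    by_contra! hall
    rw [Set.eq_univ_of_forall hall] at hdim
    exact lt_irrefl _ hdim
  simp only [Set.mem_iUnion, not_exists, Set.mem_range] at hφ
  have hφ0 : ∑ x, ‖φ x‖ ^ 2 ≠ 0 := by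
    intro h0
    have h4 : 2 ^ (1 + 1) ≤ 2 ^ (n + 1) := Nat.pow_le_pow_right (by norm_num) (by omega)
    -- The zero vector is itself excluded, by no gates and the scalar zero; this needs 2 < 2^(n+1).
    refine hφ [] (by simp only [List.length_nil]; omega) 0 (0, 0) (funext fun x => ?_)
    have := (Finset.sum_eq_zero_iff_of_nonneg (fun i _ => by positivity)).1 h0 x
      (Finset.mem_univ _)
    have hx : φ x = 0 := norm_eq_zero.1 (pow_eq_zero_iff two_ne_zero |>.1 this)
    simp [R, hx]
  set r := Real.sqrt (∑ x, ‖φ x‖ ^ 2) with hr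
  have hr0 : r ≠ 0 := by
    rw [hr, Real.sqrt_ne_zero (Finset.sum_nonneg fun i _ => by positivity)]
    exact hφ0
  refine ⟨fun x => (r : ℂ)⁻¹ * φ x, ?_, fun G a y hG => ?_⟩
  · simp only [IsState, norm_mul, mul_pow, ← Finset.mul_sum, norm_inv, Complex.norm_real,
      Real.norm_eq_abs, inv_pow, sq_abs]
    rw [hr, Real.sq_sqrt (Finset.sum_nonneg fun i _ => by positivity)]
    exact inv_mul_cancel₀ hφ0
  · by_contra! hlt
    obtain ⟨p, hp⟩ := hrun (G.reverse.map Gate.shape) G.reverse rfl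
    rw [List.reverse_reverse] at hp
    refine hφ (G.reverse.map Gate.shape) (by simpa using hlt) y (r * a, p) (funext fun x => ?_)
    have hx := congrFun hG x
    have hrC : (r : ℂ) ≠ 0 := by exact_mod_cast hr0
    simp only [R]
    rw [hp, mul_assoc, ← hx, mul_inv_cancel_left₀ hrC]

theorem four_mul_mul_two_pow_lt {n d : ℕ} (hd : 1 ≤ d) (hn : 16 * d + 1 ≤ n) :
    4 * n * 2 ^ d < 2 ^ n := by
  induction n, hn using Nat.le_induction with
  | base =>
    have h1 : d < 2 ^ d := Nat.lt_two_pow_self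
    have h2 : 2 ^ (2 * d + 7) ≤ 2 ^ (16 * d + 1) :=
      Nat.pow_le_pow_right (by norm_num) (by omega)
    have h3 : 2 ^ (2 * d + 7) = 128 * (2 ^ d * 2 ^ d) := by ring
    have h4 : d * 2 ^ d < 2 ^ d * 2 ^ d := Nat.mul_lt_mul_of_pos_right h1 (by positivity)
    have h5 : 1 * 2 ^ d ≤ d * 2 ^ d := Nat.mul_le_mul_right _ hd
    nlinarith
  | succ n hn ih =>
    have h5 : 1 * 2 ^ d ≤ n * 2 ^ d := Nat.mul_le_mul_right _ (by omega)
    rw [pow_succ]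
    nlinarith

/-- The same generic state serves both bounds. Counting the whole circuit gives 2^n ≤ 8·size,
counting the light cone gives n ≤ 16·depth, and size ≤ depth·(n+m) gives 2^n/(n+m) ≤ 8·depth. -/
theorem exists_state_lower_bound (n m : ℕ) (hn : 1 ≤ n) :
    ∃ ψ : Amplitudes (Fin n), IsState ψ ∧ ∀ C : Circuit (Fin n ⊕ Fin m), Prepares C ψ →
      (1 / 32 : ℝ) * ((n : ℝ) + (2 : ℝ) ^ n / ((n : ℝ) + (m : ℝ))) ≤ (C.depth : ℝ) ∧
      (1 / 32 : ℝ) * (2 : ℝ) ^ n ≤ (C.size : ℝ) := by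
  obtain ⟨ψ, hψ, hgen⟩ := exists_state_forall_run_ne n m hn
  refine ⟨ψ, hψ, fun C hC => ?_⟩
  have h2 : 2 ^ 1 ≤ 2 ^ n := Nat.pow_le_pow_right (by norm_num) hn
  have hsize : 2 ^ n ≤ 8 * C.size := by
    have := hgen C.gates 1 0 (by
      rw [← Circuit.apply_eq_run, show C.apply _ = _ from hC]
      funext x
      simp [tensor, ketZero, funext_iff])
    rw [← C.size_eq_length, pow_succ] at this
    omega
  have hψ0 : ψ ≠ 0 := by
    rintro rfl
    simp [IsState] at hψ
  have hdepth : n ≤ 16 * C.depth := by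
    obtain ⟨G, a, y, hG, h⟩ := hC.exists_run hψ0
    have h1 := hgen G a y h
    rw [pow_succ] at h1
    by_contra! hlt
    rcases Nat.eq_zero_or_pos C.depth with h0 | h0
    · rw [h0] at hG
      omega
    · have := four_mul_mul_two_pow_lt h0 hlt
      nlinarith
  have hcard := C.size_le
  rw [Fintype.card_sum, Fintype.card_fin, Fintype.card_fin] at hcard
  have hsize' : (2 : ℝ) ^ n ≤ 8 * C.size := by exact_mod_cast hsize
  have hdepth' : (n : ℝ) ≤ 16 * C.depth := by exact_mod_cast hdepth
  have hcard' : (C.size : ℝ) ≤ C.depth * (n + m) := by exact_mod_cast hcard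
  have hn' : (1 : ℝ) ≤ n := by exact_mod_cast hn
  have hpos : (0 : ℝ) < n + m := by positivity
  constructor
  · have : (2 : ℝ) ^ n / (n + m) ≤ 8 * C.depth := by
      rw [div_le_iff₀ hpos]
      linarith
    linarith
  · have : (0 : ℝ) < 2 ^ n := by positivity
    linarith

end Counting

end QSP

/-! ### The main theorem -/

theorem theorem2 :
    -- Upper bounds, achieved by one and the same circuit.
    (∃ K : ℝ, 0 < K ∧ ∀ n m : ℕ, 1 ≤ n → ∀ ψ : QSP.Amplitudes (Fin n), QSP.IsState ψ →
      ∃ C : QSP.Circuit (Fin n ⊕ Fin m), QSP.Prepares C ψ ∧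
        (C.depth : ℝ) ≤ K * ((n : ℝ) + (2 : ℝ) ^ n / ((n : ℝ) + (m : ℝ))) ∧
        (C.size : ℝ) ≤ K * (2 : ℝ) ^ n) ∧
    -- Optimality of both bounds, for every number of ancillary qubits.
    (∃ c : ℝ, 0 < c ∧ ∀ n m : ℕ, 1 ≤ n →
      (∃ ψ : QSP.Amplitudes (Fin n), QSP.IsState ψ ∧
        ∀ C : QSP.Circuit (Fin n ⊕ Fin m), QSP.Prepares C ψ →
          c * ((n : ℝ) + (2 : ℝ) ^ n / ((n : ℝ) + (m : ℝ))) ≤ (C.depth : ℝ)) ∧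
      (∃ ψ : QSP.Amplitudes (Fin n), QSP.IsState ψ ∧
        ∀ C : QSP.Circuit (Fin n ⊕ Fin m), QSP.Prepares C ψ →
          c * (2 : ℝ) ^ n ≤ (C.size : ℝ))) := by
  refine ⟨⟨3600, by norm_num, fun n m hn ψ hψ => QSP.exists_prepares n m hn ψ hψ⟩,
    1 / 32, by norm_num, fun n m hn => ?_⟩
  obtain ⟨ψ, hψ, h⟩ := QSP.exists_state_lower_bound n m hn
  exact ⟨⟨ψ, hψ, fun C hC => (h C hC).1⟩, ψ, hψ, fun C hC => (h C hC).2⟩
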